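/- Let $k\ge 2$ be an integer. There is a constant $c=c(k)>0$ such that the following holds for every integer $r$ with $2\le r\le k$ for which $k\ge 4$ or $r\ge 3$. Let $H$ be a $k$-uniform linear hypergraph with $m$ hyperedges, that is, a set of $m$ distinct hyperedges, each consisting of exactly $k$ vertices, such that any two distinct hyperedges share at most one vertex. Then $H$ has an $r$-cut of surplus at least $c\,m^{3/4}$. Here an $r$-cut is a partition of the vertex set of $H$ into $r$ parts (possibly empty), its size is the number of hyperedges having at least one vertex in each of the $r$ parts, and its surplus is its size minus $\frac{S(k,r)\,r!}{r^k}\,m$, where $S(k,r)$ is the Stirling number of the second kind (so the subtracted quantity is the expected size of a uniformly random $r$-cut). -/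

import Mathlib

namespace Hypergraph

/-- `H` is `k`-uniform: every hyperedge has exactly `k` vertices. -/
def IsUniform {V : Type*} (H : Hypergraph V) (k : ℕ) : Prop :=
  ∀ e ∈ H.edgeSet, e.encard = k

/-- `H` is linear: any two distinct hyperedges share at most one vertex. -/
def IsLinear {V : Type*} (H : Hypergraph V) : Prop :=
  ∀ e ∈ H.edgeSet, ∀ f ∈ H.edgeSet, e ≠ f → (e ∩ f).encard ≤ 1

/-- An `r`-cut of `H`: a partition of the vertex set into `r` labelled parts. As for a uniformly
random assignment of the vertices to the parts, a part may be empty. -/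
structure Cut {V : Type*} (H : Hypergraph V) (r : ℕ) where
  /-- The parts of the cut. -/
  part : Fin r → Set V
  /-- Distinct parts are disjoint. -/
  disjoint : ∀ i j, i ≠ j → Disjoint (part i) (part j)
  /-- The parts cover exactly the vertex set. -/
  iUnion_part : ⋃ i, part i = H.vertexSet

/-- The size of an `r`-cut: the number of hyperedges with at least one vertex in each part. -/
noncomputable def Cut.size {V : Type*} {H : Hypergraph V} {r : ℕ} (P : H.Cut r) : ℕ :=
  {e ∈ H.edgeSet | ∀ i, (e ∩ P.part i).Nonempty}.ncard

/-- The surplus of an `r`-cut of a `k`-uniform hypergraph with `m` hyperedges: its size minus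
`S(k,r) r! / r ^ k * m`, the expected size of a uniformly random `r`-cut. -/
noncomputable def Cut.surplus {V : Type*} {H : Hypergraph V} {r : ℕ} (P : H.Cut r) (k : ℕ) : ℝ :=
  (P.size : ℝ) -
    (Nat.stirlingSecond k r : ℝ) * (Nat.factorial r : ℝ) / (r : ℝ) ^ k * (H.edgeSet.ncard : ℝ)

end Hypergraph

/-!
Every linear `k`-uniform hypergraph with `m` hyperedges has an `r`-cut of surplus of order
`m ^ (3 / 4)`. The cut is a random one, built in two rounds.

By linearity, at least half of the hyperedges contain a vertex of degree at most `2 * k * √m`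
(`card_le_two_mul_card_inter_nonempty`), so there is a set `Y` of such vertices which a constant
proportion of all hyperedges meets exactly once (`exists_subset_card_inter_eq_one`). The vertices
outside `Y` are coloured uniformly at random. Afterwards each `v ∈ Y` is given a random colour with
a bias between the colours `0` and `1` that depends on the colours already present. A hyperedge `f`
with `f ∩ Y = {v}` contributes to this bias through a test function `ψ f` of the colours of its
other vertices, which correlates with the gain from giving `v` the colour `0` rather than `1`
(`exists_testFunction`).

There are two points. The first is that the biases have to be bounded without losing their first
order term. A sum of about `√m` nearly independent test functions with coefficient
`lam = δ / m ^ (1 / 4)` is bounded in mean square only; the imaginary part of the Riesz product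
`∏ (1 + lam * I * ψ f)` has the same correlation with each `ψ f` and is bounded
(`TestFamily.bias`). Each of the hyperedges meeting `Y` once therefore gains about `lam`
(`TestFamily.expect_bias_mul_of_mem`), which adds up to `m ^ (3 / 4)`.

The second point is that hyperedges with at least two vertices in `Y` must not lose as much. This
requires that the biases of the vertices of one hyperedge are nearly uncorrelated. For this `ψ f`
is chosen such that it averages to zero over the colour of each of two vertices of `f`; this is
possible unless `k = 3` and `r = 2`. As two hyperedges share at most one vertex, products of two
test functions then still have mean zero, and a product of Riesz products has mean
`1 + O(√m * lam ^ 3) = 1 + O(δ ^ 2 * lam)` (`norm_expect_mul_prod_one_add_sub_le`), whatever the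
signs of the coefficients. In a product of imaginary parts the terms `1` cancel
(`TestFamily.abs_expect_prod_bias_mul_le`), and for small `δ` the total loss is smaller than the
gain.
-/

open Finset
open scoped BigOperators

namespace RandomColoring

/-! ### Averages over random colourings -/

section Average

variable {V K 𝕜 : Type*} [DecidableEq V]

/-- `F` does not depend on the colour of `x`. -/
def ConstAt (x : V) (F : (V → K) → 𝕜) : Prop :=
  ∀ c a, F (Function.update c x a) = F c

/-- Averaging `F` over the colour of `x` gives zero, whatever the other colours are. -/
def MeanZeroAt [Fintype K] [AddCommMonoid 𝕜] (x : V) (F : (V → K) → 𝕜) : Prop :=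
  ∀ c, ∑ a, F (Function.update c x a) = 0

lemma ConstAt.of_eq {x : V} {F : (V → K) → 𝕜}
    (h : ∀ c c' : V → K, (∀ v, v ≠ x → c v = c' v) → F c = F c') : ConstAt x F :=
  fun _ _ => h _ _ fun _ hv => Function.update_of_ne hv _ _

lemma ConstAt.mul [Mul 𝕜] {x : V} {F G : (V → K) → 𝕜} (hF : ConstAt x F) (hG : ConstAt x G) :
    ConstAt x fun c => F c * G c :=
  fun c a => by simp only [hF c a, hG c a]

lemma ConstAt.prod [CommMonoid 𝕜] {ι : Type*} {x : V} {F : ι → (V → K) → 𝕜} {s : Finset ι}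
    (hF : ∀ i ∈ s, ConstAt x (F i)) : ConstAt x fun c => ∏ i ∈ s, F i c :=
  fun c a => prod_congr rfl fun i hi => hF i hi c a

lemma ConstAt.comp {𝕜' : Type*} {x : V} {F : (V → K) → 𝕜} (hF : ConstAt x F) (g : 𝕜 → 𝕜') :
    ConstAt x fun c => g (F c) :=
  fun c a => by simp only [hF c a]

lemma MeanZeroAt.mul [Fintype K] [NonUnitalNonAssocSemiring 𝕜] {x : V} {F G : (V → K) → 𝕜}
    (hF : MeanZeroAt x F) (hG : ConstAt x G) : MeanZeroAt x fun c => F c * G c := fun c => by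
  simp only [hG c, ← sum_mul, hF c, zero_mul]

variable [Fintype V] [Fintype K] [Nonempty K] [Field 𝕜] [CharZero 𝕜]

lemma expect_update (x : V) (F : (V → K) → 𝕜) :
    𝔼 c, 𝔼 a, F (Function.update c x a) = 𝔼 c, F c := by
  have h : ∑ p : (V → K) × K, F (Function.update p.1 x p.2) = ∑ p : (V → K) × K, F p.1 := by
    refine Fintype.sum_equiv
      ⟨fun p => (Function.update p.1 x p.2, p.1 x), fun p => (Function.update p.1 x p.2, p.1 x),
        fun p => by simp, fun p => by simp⟩ _ _ fun p => rfl
  rw [Fintype.sum_prod_type, Fintype.sum_prod_type] at h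
  simp only [sum_const, card_univ, nsmul_eq_mul, ← mul_sum] at h
  have hK : (Fintype.card K : 𝕜) ≠ 0 := by simp
  simp only [Fintype.expect_eq_sum_div_card, ← sum_div, h]
  field_simp

lemma MeanZeroAt.expect_eq_zero {x : V} {F : (V → K) → 𝕜} (hF : MeanZeroAt x F) :
    𝔼 c, F c = 0 := by
  rw [← expect_update x]
  exact Finset.expect_eq_zero fun c _ => by
    rw [Fintype.expect_eq_sum_div_card, hF c, zero_div]

/-- A product of factors `1 + ξ j` is uncorrelated with `F` if every `ξ j` averages to zero over a
coordinate `x j` on which neither `F` nor any other factor depends. -/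
lemma expect_mul_prod_one_add_eq {ι : Type*} [DecidableEq ι] (F : (V → K) → 𝕜)
    (ξ : ι → (V → K) → 𝕜) (T : Finset ι) (x : ι → V) (hξ : ∀ j ∈ T, MeanZeroAt (x j) (ξ j))
    (hF : ∀ j ∈ T, ConstAt (x j) F) (hx : ∀ j ∈ T, ∀ l ∈ T, l ≠ j → ConstAt (x j) (ξ l)) :
    𝔼 c, F c * ∏ j ∈ T, (1 + ξ j c) = 𝔼 c, F c := by
  induction T using Finset.induction_on with
  | empty => simp
  | insert a T ha ih =>
    have h0 : MeanZeroAt (x a) fun c => ξ a c * (F c * ∏ j ∈ T, (1 + ξ j c)) :=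
      (hξ a (mem_insert_self a T)).mul ((hF a (mem_insert_self a T)).mul
        (ConstAt.prod fun j hj => (hx a (mem_insert_self a T) j (mem_insert_of_mem hj)
          fun hja => ha (hja ▸ hj)).comp fun z => 1 + z))
    rw [← ih (fun j hj => hξ j (mem_insert_of_mem hj)) (fun j hj => hF j (mem_insert_of_mem hj))
      fun j hj l hl => hx j (mem_insert_of_mem hj) l (mem_insert_of_mem hl), ← sub_eq_zero,
      ← expect_sub_distrib, ← h0.expect_eq_zero]
    refine expect_congr rfl fun c _ => ?_
    rw [prod_insert ha]
    ring

end Average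

lemma norm_expect_le_of_forall {α : Type*} [Fintype α] [Nonempty α] {F : α → ℂ} {B : ℝ}
    (h : ∀ c, ‖F c‖ ≤ B) : ‖𝔼 c, F c‖ ≤ B :=
  (RCLike.norm_expect_le (K := ℂ)).trans
    ((expect_le_expect fun c _ => h c).trans_eq (Fintype.expect_const B))

/-! ### Products of perturbed factors -/

section Removal

variable {Ω ι : Type*} [Fintype Ω] [DecidableEq ι]

/-- Deleting the factors `1 + ξ m` with `p m` from a product one at a time changes its correlation
with `F` by at most `ε` for each of them, if every correlation of `F * ξ m` with a product of
other factors is at most `ε`. -/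
lemma norm_expect_prod_sub_filter_le (F : Ω → ℂ) (ξ : ι → Ω → ℂ) (T : Finset ι) (p : ι → Prop)
    [DecidablePred p] {ε : ℝ}
    (h : ∀ m ∈ T, p m → ∀ S ⊆ T, m ∉ S → ‖𝔼 c, F c * ξ m c * ∏ j ∈ S, (1 + ξ j c)‖ ≤ ε) :
    ‖𝔼 c, F c * ∏ j ∈ T, (1 + ξ j c) - 𝔼 c, F c * ∏ j ∈ T.filter (fun j => ¬ p j), (1 + ξ j c)‖
      ≤ #(T.filter p) * ε := by
  induction T using Finset.induction_on generalizing F with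
  | empty => simp
  | insert a T ha ih =>
    by_cases hpa : p a
    · have ih' := ih F fun m hm hpm S hS hmS =>
        h m (mem_insert_of_mem hm) hpm S (hS.trans (subset_insert a T)) hmS
      rw [filter_insert, filter_insert, if_neg (not_not_intro hpa), if_pos hpa,
        card_insert_of_notMem (by simp [ha])]
      have h1 : 𝔼 c, F c * ∏ j ∈ insert a T, (1 + ξ j c)
          = 𝔼 c, F c * ∏ j ∈ T, (1 + ξ j c) + 𝔼 c, F c * ξ a c * ∏ j ∈ T, (1 + ξ j c) := by
        rw [← expect_add_distrib]
        refine expect_congr rfl fun c _ => ?_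
        rw [prod_insert ha]
        ring
      have h2 := h a (mem_insert_self a T) hpa T (subset_insert a T) ha
      rw [h1, add_sub_right_comm]
      refine (norm_add_le _ _).trans ?_
      push_cast
      linarith
    · -- A factor that is kept is absorbed into `F`.
      rw [filter_insert, filter_insert, if_pos hpa, if_neg hpa]
      have key : ∀ S : Finset ι, a ∉ S → ∀ G : Ω → ℂ,
          𝔼 c, G c * ∏ j ∈ insert a S, (1 + ξ j c)
            = 𝔼 c, (G c * (1 + ξ a c)) * ∏ j ∈ S, (1 + ξ j c) := fun S hS G =>
        expect_congr rfl fun c _ => by rw [prod_insert hS]; ring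
      rw [key T ha, key _ (by simp [ha])]
      refine ih _ fun m hm hpm S hS hmS => ?_
      have haS : a ∉ S := fun haS => ha (hS haS)
      have h1 := h m (mem_insert_of_mem hm) hpm (insert a S) (insert_subset_insert a hS) (by
        simp only [mem_insert, not_or]
        exact ⟨fun hma => ha (hma ▸ hm), hmS⟩)
      rw [key S haS fun c => F c * ξ m c] at h1
      refine le_of_eq_of_le (congrArg _ (expect_congr rfl fun c _ => ?_)) h1
      ring

end Removal

section Decoupling

variable {V K ι : Type*} [DecidableEq V] [Fintype V] [Fintype K] [Nonempty K] [DecidableEq ι]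

/-- Let the functions `ξ j` be small, supported on sets `W j` that pairwise share at most one
vertex and of which at most `D` contain a given vertex, and let each `ξ j` average to zero over
each of two vertices of `W j`. Then the product of the `1 + ξ j` has mean nearly one, and is nearly
uncorrelated with every bounded `G` not depending on the colours in the sets `W j`.

Expanding the product, the terms linear and quadratic in the `ξ j` vanish, so that only triples of
functions whose supports form a connected configuration contribute. -/
lemma norm_expect_mul_prod_one_add_sub_le (G : (V → K) → ℂ) (ξ : ι → (V → K) → ℂ) (T : Finset ι)
    (W : ι → Finset V) (x₁ x₂ : ι → V) {lam B : ℝ} {D : ℕ}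
    (hlam : 0 ≤ lam) (hG : ∀ c, ‖G c‖ ≤ 1) (hξ : ∀ j ∈ T, ∀ c, ‖ξ j c‖ ≤ lam)
    (hB : ∀ S ⊆ T, ∀ c, ‖∏ j ∈ S, (1 + ξ j c)‖ ≤ B)
    (hGW : ∀ j ∈ T, ∀ x ∈ W j, ConstAt x G)
    (hW : ∀ j ∈ T, ∀ x ∉ W j, ConstAt x (ξ j))
    (hx₁ : ∀ j ∈ T, x₁ j ∈ W j) (hx₂ : ∀ j ∈ T, x₂ j ∈ W j) (hx : ∀ j ∈ T, x₁ j ≠ x₂ j)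
    (hm₁ : ∀ j ∈ T, MeanZeroAt (x₁ j) (ξ j)) (hm₂ : ∀ j ∈ T, MeanZeroAt (x₂ j) (ξ j))
    (hlin : ∀ j ∈ T, ∀ l ∈ T, j ≠ l → ∀ u ∈ W j, u ∈ W l → ∀ v ∈ W j, v ∈ W l → u = v)
    (hD : ∀ x, #(T.filter fun j => x ∈ W j) ≤ D) :
    ‖𝔼 c, G c * ∏ j ∈ T, (1 + ξ j c) - 𝔼 c, G c‖ ≤ #T * (D * (D * (lam ^ 3 * B))) := by
  have hB0 : 0 ≤ B := (norm_nonneg _).trans (hB ∅ (empty_subset T) fun _ => Classical.arbitrary K)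
  have hDS : ∀ S ⊆ T, ∀ x, #(S.filter fun j => x ∈ W j) ≤ D := fun S hS x =>
    (card_le_card (filter_subset_filter _ hS)).trans (hD x)
  have hprod : ∀ S ⊆ T, ∀ x, ConstAt x fun c => ∏ j ∈ S.filter fun j => ¬ x ∈ W j, (1 + ξ j c) :=
    fun S hS x => ConstAt.prod fun j hj =>
      ((hW j (hS (mem_filter.1 hj).1) x (mem_filter.1 hj).2).comp fun z => 1 + z)
  have third : ∀ j ∈ T, ∀ l ∈ T, ∀ m ∈ T, ∀ S ⊆ T,
      ‖𝔼 c, G c * ξ j c * ξ l c * ξ m c * ∏ i ∈ S, (1 + ξ i c)‖ ≤ lam ^ 3 * B := by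
    intro j hj l hl m hm S hS
    refine norm_expect_le_of_forall fun c => ?_
    simp only [norm_mul]
    calc ‖G c‖ * ‖ξ j c‖ * ‖ξ l c‖ * ‖ξ m c‖ * ‖∏ i ∈ S, (1 + ξ i c)‖
        ≤ 1 * lam * lam * lam * B := by
          gcongr
          exacts [hG c, hξ j hj c, hξ l hl c, hξ m hm c, hB S hS c]
      _ = lam ^ 3 * B := by ring
  have second : ∀ j ∈ T, ∀ l ∈ T, j ≠ l → x₁ j ∈ W l → ∀ S ⊆ T, j ∉ S →
      ‖𝔼 c, G c * ξ j c * ξ l c * ∏ i ∈ S, (1 + ξ i c)‖ ≤ D * (lam ^ 3 * B) := by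
    intro j hj l hl hjl hxl S hS _
    -- As `W j` and `W l` meet in `x₁ j` only, `ξ l` does not depend on the colour of `x₂ j`.
    have hx₂l : x₂ j ∉ W l := fun hmem =>
      hx j hj (hlin j hj l hl hjl _ (hx₁ j hj) hxl _ (hx₂ j hj) hmem)
    have h0 : MeanZeroAt (x₂ j) fun c =>
        ξ j c * (G c * ξ l c * ∏ i ∈ S.filter fun i => ¬ x₂ j ∈ W i, (1 + ξ i c)) :=
      (hm₂ j hj).mul (((hGW j hj _ (hx₂ j hj)).mul (hW l hl _ hx₂l)).mul (hprod S hS _))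
    have h1 := norm_expect_prod_sub_filter_le (fun c => G c * ξ j c * ξ l c) ξ S
      (fun i => x₂ j ∈ W i) (ε := lam ^ 3 * B)
      fun m hm _ S' hS' _ => third j hj l hl m (hS hm) S' (hS'.trans hS)
    have h2 : 𝔼 c, G c * ξ j c * ξ l c * ∏ i ∈ S.filter fun i => ¬ x₂ j ∈ W i, (1 + ξ i c) = 0 := by
      rw [← h0.expect_eq_zero (𝕜 := ℂ)]
      exact expect_congr rfl fun c _ => by ring
    rw [h2, sub_zero] at h1
    exact h1.trans (by gcongr; exact hDS S hS _)
  have first : ∀ j ∈ T, ∀ S ⊆ T, j ∉ S →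
      ‖𝔼 c, G c * ξ j c * ∏ i ∈ S, (1 + ξ i c)‖ ≤ D * (D * (lam ^ 3 * B)) := by
    intro j hj S hS hjS
    have h0 : MeanZeroAt (x₁ j) fun c =>
        ξ j c * (G c * ∏ i ∈ S.filter fun i => ¬ x₁ j ∈ W i, (1 + ξ i c)) :=
      (hm₁ j hj).mul ((hGW j hj _ (hx₁ j hj)).mul (hprod S hS _))
    have h1 := norm_expect_prod_sub_filter_le (fun c => G c * ξ j c) ξ S
      (fun i => x₁ j ∈ W i) (ε := D * (lam ^ 3 * B))
      fun l hl hxl S' hS' _ => second j hj l (hS hl) (fun h => hjS (h ▸ hl)) hxl S'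
        (hS'.trans hS) fun h => hjS (hS' h)
    have h2 : 𝔼 c, G c * ξ j c * ∏ i ∈ S.filter fun i => ¬ x₁ j ∈ W i, (1 + ξ i c) = 0 := by
      rw [← h0.expect_eq_zero (𝕜 := ℂ)]
      exact expect_congr rfl fun c _ => by ring
    rw [h2, sub_zero] at h1
    exact h1.trans (by gcongr; exact hDS S hS _)
  simpa using norm_expect_prod_sub_filter_le G ξ T (fun _ => True)
    fun j hj _ S hS hjS => first j hj S hS hjS

end Decoupling

/-! ### Surjective colourings of a set and Stirling numbers -/

section Surjective

variable {V K : Type*} [DecidableEq K]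

/-- The indicator function of the event that all colours occur on `s`. -/
def rainbow [Fintype K] (s : Finset V) (c : V → K) : ℝ :=
  if ∀ i, ∃ v ∈ s, c v = i then 1 else 0

lemma rainbow_nonneg [Fintype K] (s : Finset V) (c : V → K) : 0 ≤ rainbow s c := by
  unfold rainbow; split_ifs <;> norm_num

lemma rainbow_le_one [Fintype K] (s : Finset V) (c : V → K) : rainbow s c ≤ 1 := by
  unfold rainbow; split_ifs <;> norm_num

lemma constAt_rainbow [DecidableEq V] [Fintype K] {s : Finset V} {x : V} (hx : x ∉ s) :
    ConstAt x (rainbow (K := K) s) := by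
  refine ConstAt.of_eq fun c c' h => ?_
  have : ∀ i, (∃ v ∈ s, c v = i) ↔ ∃ v ∈ s, c' v = i := fun i =>
    exists_congr fun v => and_congr_right fun hv => by rw [h v fun hvx => hx (hvx ▸ hv)]
  simp only [rainbow, this]

variable [DecidableEq V] [Fintype V] [Fintype K] [Nonempty K]

lemma expect_image_eq (s : Finset V) (T : Finset K) :
    𝔼 c : V → K, (if s.image c = T then (1 : ℝ) else 0)
      = Nat.stirlingSecond #s #T * (#T).factorial / (Fintype.card K : ℝ) ^ #s := by
  induction s using Finset.induction_on generalizing T with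
  | empty =>
    rcases T.eq_empty_or_nonempty with rfl | hT
    · simp
    · obtain ⟨n, hn⟩ := Nat.exists_eq_succ_of_ne_zero hT.card_pos.ne'
      simp [hT.ne_empty.symm, hn]
  | insert x s hx ih =>
    have hK : (Fintype.card K : ℝ) ≠ 0 := by simp
    have hupd : ∀ c : V → K, ∀ a, (insert x s).image (Function.update c x a)
        = insert a (s.image c) := fun c a => by
      rw [image_insert, Function.update_self]
      congr 1
      exact image_congr fun v hv =>
        Function.update_of_ne (fun h : v = x => hx (h ▸ mem_coe.1 hv)) _ _
    -- Given the colour `a ∈ T` of `x`, the colours on `s` have to form `T` or `T.erase a`.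
    have hstep : ∀ c : V → K, ∀ a, (if insert a (s.image c) = T then (1 : ℝ) else 0)
        = if a ∈ T then (if s.image c = T then 1 else 0)
            + (if s.image c = T.erase a then 1 else 0) else 0 := by
      intro c a
      by_cases ha : a ∈ T
      · have h1 : insert a (s.image c) = T ↔ s.image c = T ∨ s.image c = T.erase a := by
          constructor
          · rintro rfl
            by_cases hmem : a ∈ s.image c
            · exact Or.inl (insert_eq_of_mem hmem).symm
            · exact Or.inr (erase_insert hmem).symm
          · rintro (h | h)
            · rw [h, insert_eq_of_mem ha]
            · rw [h, insert_erase ha]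
        have h2 : ¬ (s.image c = T ∧ s.image c = T.erase a) := fun h =>
          notMem_erase a T (h.2 ▸ h.1 ▸ ha)
        by_cases h3 : s.image c = T <;> by_cases h4 : s.image c = T.erase a
        · exact absurd ⟨h3, h4⟩ h2
        · rw [if_pos ha, if_pos (h1.2 (Or.inl h3)), if_pos h3, if_neg h4, add_zero]
        · rw [if_pos ha, if_pos (h1.2 (Or.inr h4)), if_neg h3, if_pos h4, zero_add]
        · rw [if_pos ha, if_neg fun h => (h1.1 h).elim h3 h4, if_neg h3, if_neg h4, add_zero]
      · have h1 : insert a (s.image c) ≠ T := fun h => ha (h ▸ mem_insert_self _ _)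
        simp [h1, ha]
    rw [← expect_update x, expect_comm]
    simp only [hupd, hstep]
    have hin : ∀ a : K, 𝔼 c : V → K, (if a ∈ T then (if s.image c = T then (1 : ℝ) else 0)
            + (if s.image c = T.erase a then 1 else 0) else 0)
        = if a ∈ T then (Nat.stirlingSecond #s #T * (#T).factorial
            + Nat.stirlingSecond #s (#T - 1) * (#T - 1).factorial) / (Fintype.card K : ℝ) ^ #s
          else 0 := by
      intro a
      split_ifs with ha
      · rw [expect_add_distrib, ih, ih, card_erase_of_mem ha, add_div]
      · simp
    simp only [hin]
    rw [Fintype.expect_eq_sum_div_card, sum_ite_mem, univ_inter, sum_const, nsmul_eq_mul,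
      card_insert_of_notMem hx]
    rcases h : #T with _ | n
    · simp
    · rw [Nat.stirlingSecond_succ_succ, Nat.factorial_succ, Nat.add_sub_cancel]
      push_cast
      field_simp
      ring

lemma expect_rainbow (s : Finset V) :
    𝔼 c : V → K, rainbow s c = Nat.stirlingSecond #s (Fintype.card K)
      * (Fintype.card K).factorial / (Fintype.card K : ℝ) ^ #s := by
  have h := expect_image_eq s (univ : Finset K)
  rw [card_univ] at h
  rw [← h]
  refine expect_congr rfl fun c _ => ?_
  simp only [rainbow, eq_univ_iff_forall, mem_image]

end Surjective

/-! ### A test function for a hyperedge -/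

section TestFunction

/-- The signed indicator `[a = i] - [a = j]` of two colours. -/
def signed {K : Type*} [DecidableEq K] (i j a : K) : ℝ :=
  (if a = i then 1 else 0) - (if a = j then 1 else 0)

lemma abs_signed_le_one {K : Type*} [DecidableEq K] (i j a : K) : |signed i j a| ≤ 1 := by
  unfold signed; split_ifs <;> norm_num

lemma sum_signed_mul {K : Type*} [DecidableEq K] [Fintype K] (i j : K) (g : K → ℝ) :
    ∑ a, signed i j a * g a = g i - g j := by
  simp [signed, sub_mul, sum_sub_distrib]

lemma sum_signed {K : Type*} [DecidableEq K] [Fintype K] (i j : K) :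
    ∑ a, signed i j a = 0 := by
  simpa using sum_signed_mul i j fun _ => 1

/-- The colours occurring on the set `R`, together with `a`, `b` and `t`, are all the colours. -/
def Completes {V K : Type*} (R : Finset V) (γ : V → K) (a b t : K) : Prop :=
  ∀ i, i = a ∨ i = b ∨ i = t ∨ ∃ v ∈ R, γ v = i

open Classical in
/-- The third mixed difference of the event that three further vertices complete the colours on `R`,
in directions `[1] - [b]`, `[1] - [b]` and `[0] - [1]`, is nonzero for a suitable colouring of `R`.
This is false for `r = 2` and `#R = 0`. -/
lemma exists_mixed_difference_le {V : Type*} {r : ℕ} (hr : 2 ≤ r) (R : Finset V)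
    (hR : r ≤ #R + 3) (h : 4 ≤ #R + 3 ∨ 3 ≤ r) :
    ∃ (b : Fin r) (γ : V → Fin r), ∑ x, signed ⟨1, hr⟩ b x * ∑ y, signed ⟨1, hr⟩ b y *
      ∑ t, signed ⟨0, by omega⟩ ⟨1, hr⟩ t * (if Completes R γ x y t then (1 : ℝ) else 0) ≤ -1 := by
  simp only [sum_signed_mul]
  rcases hr.eq_or_lt with rfl | hr3
  · obtain ⟨v, hv⟩ : R.Nonempty := card_pos.1 (by omega)
    refine ⟨0, fun _ => 0, ?_⟩
    have e0 : (⟨0, by omega⟩ : Fin 2) = 0 := rfl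
    have e1 : (⟨1, hr⟩ : Fin 2) = 1 := rfl
    have hex : ∀ i : Fin 2, (∃ v ∈ R, (0 : Fin 2) = i) ↔ i = 0 := fun i =>
      ⟨fun ⟨_, _, h⟩ => h.symm, fun h => ⟨v, hv, h.symm⟩⟩
    simp only [Completes, e0, e1, hex, Fin.forall_fin_two]
    norm_num
  · -- The colours from `3` on occur on `R`, the colours `0` and `1` do not.
    obtain ⟨γ, h0, h1, h3⟩ : ∃ γ : V → Fin r, (∀ v ∈ R, (γ v : ℕ) ≠ 0) ∧ (∀ v ∈ R, (γ v : ℕ) ≠ 1) ∧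
        ∀ i : Fin r, 3 ≤ (i : ℕ) → ∃ v ∈ R, γ v = i := by
      refine ⟨fun v => if hv : v ∈ R then
        (if h : (R.equivFin ⟨v, hv⟩ : ℕ) + 3 < r then ⟨_, h⟩ else ⟨2, hr3⟩) else ⟨2, hr3⟩,
        fun v hv => ?_, fun v hv => ?_, fun i hi => ?_⟩
      · simp only [dif_pos hv]; split_ifs <;> simp
      · simp only [dif_pos hv]; split_ifs <;> simp
      · have hlt : (i : ℕ) - 3 < #R := by omega
        refine ⟨R.equivFin.symm ⟨i - 3, hlt⟩, (R.equivFin.symm ⟨i - 3, hlt⟩).2, ?_⟩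
        have h' : (i : ℕ) - 3 + 3 < r := by omega
        simp only [coe_mem, dif_pos, Subtype.coe_eta, Equiv.apply_symm_apply, h']
        exact Fin.ext (by simp; omega)
    refine ⟨⟨2, hr3⟩, γ, ?_⟩
    have n0 : ∀ x y t : Fin r, (x : ℕ) ≠ 0 → (y : ℕ) ≠ 0 → (t : ℕ) ≠ 0 →
        ¬ Completes R γ x y t := by
      intro x y t hx hy ht hc
      rcases hc ⟨0, by omega⟩ with h | h | h | ⟨v, hv, h⟩
      · exact hx (by rw [← h])
      · exact hy (by rw [← h])
      · exact ht (by rw [← h])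
      · exact h0 v hv (by rw [h])
    have n1 : ∀ x y t : Fin r, (x : ℕ) ≠ 1 → (y : ℕ) ≠ 1 → (t : ℕ) ≠ 1 →
        ¬ Completes R γ x y t := by
      intro x y t hx hy ht hc
      rcases hc ⟨1, by omega⟩ with h | h | h | ⟨v, hv, h⟩
      · exact hx (by rw [← h])
      · exact hy (by rw [← h])
      · exact ht (by rw [← h])
      · exact h1 v hv (by rw [h])
    have y12 : Completes R γ ⟨1, hr⟩ ⟨2, hr3⟩ ⟨0, by omega⟩ := by
      intro i
      by_cases hi : 3 ≤ (i : ℕ)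
      · exact Or.inr (Or.inr (Or.inr (h3 i hi)))
      · simp only [Fin.ext_iff]; omega
    have y21 : Completes R γ ⟨2, hr3⟩ ⟨1, hr⟩ ⟨0, by omega⟩ := by
      intro i
      by_cases hi : 3 ≤ (i : ℕ)
      · exact Or.inr (Or.inr (Or.inr (h3 i hi)))
      · simp only [Fin.ext_iff]; omega
    rw [if_neg (n0 ⟨1, hr⟩ ⟨1, hr⟩ ⟨1, hr⟩ (by simp) (by simp) (by simp)),
      if_pos y12, if_neg (n0 ⟨1, hr⟩ ⟨2, hr3⟩ ⟨1, hr⟩ (by simp) (by simp) (by simp)),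
      if_pos y21, if_neg (n0 ⟨2, hr3⟩ ⟨1, hr⟩ ⟨1, hr⟩ (by simp) (by simp) (by simp)),
      if_neg (n1 ⟨2, hr3⟩ ⟨2, hr3⟩ ⟨0, by omega⟩ (by simp) (by simp) (by simp)),
      if_neg (n0 ⟨2, hr3⟩ ⟨2, hr3⟩ ⟨1, hr⟩ (by simp) (by simp) (by simp))]
    split_ifs <;> norm_num

variable {V : Type*} [DecidableEq V] [Fintype V] {r : ℕ}

lemma expect_cylinder {K : Type*} [DecidableEq K] [Fintype K] [Nonempty K] (R : Finset V)
    (γ : V → K) :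
    𝔼 c : V → K, (if ∀ v ∈ R, c v = γ v then (1 : ℝ) else 0) = 1 / (Fintype.card K : ℝ) ^ #R := by
  have h : univ.filter (fun c : V → K => ∀ v ∈ R, c v = γ v)
      = Fintype.piFinset fun v => if v ∈ R then {γ v} else univ := by
    ext c
    simp only [mem_filter, mem_univ, true_and, Fintype.mem_piFinset]
    refine forall_congr' fun v => ?_
    split_ifs with hv <;> simp [hv]
  have hK : (Fintype.card K : ℝ) ≠ 0 := by simp
  have h2 : ∀ v, #(if v ∈ R then {γ v} else (univ : Finset K))
      = if v ∈ R then 1 else Fintype.card K := fun v => by split_ifs <;> simp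
  rw [Fintype.expect_eq_sum_div_card, sum_boole, h, Fintype.card_piFinset, Fintype.card_fun]
  simp only [h2]
  rw [prod_ite, prod_const_one, one_mul, prod_const, filter_not, filter_mem_eq_inter, univ_inter,
    ← compl_eq_univ_sdiff, card_compl]
  push_cast
  rw [div_eq_div_iff (by positivity) (by positivity), one_mul, ← pow_add,
    Nat.sub_add_cancel (card_le_univ R)]

/-- For a vertex `y` of a hyperedge `e` there is a bounded function `ψ` of the colours of the
other vertices of `e` that averages to zero over each of two of these vertices and that tells
whether `e` gains from `y` having colour `0` rather than `1`. -/
lemma exists_testFunction (e : Finset V) {y : V} (hy : y ∈ e) (hr : 2 ≤ r) (hrk : r ≤ #e)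
    (h : 4 ≤ #e ∨ 3 ≤ r) :
    ∃ (ψ : (V → Fin r) → ℝ) (x₁ x₂ : V), x₁ ≠ x₂ ∧ x₁ ∈ e.erase y ∧ x₂ ∈ e.erase y ∧
      MeanZeroAt x₁ ψ ∧ MeanZeroAt x₂ ψ ∧ (∀ x ∉ e.erase y, ConstAt x ψ) ∧ (∀ c, |ψ c| ≤ 1) ∧
      1 / (r : ℝ) ^ #e ≤
        𝔼 c, ψ c * (signed ⟨0, by omega⟩ ⟨1, hr⟩ (c y) * rainbow e c) := by
  classical
  have : NeZero r := ⟨by omega⟩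
  obtain ⟨x₁, hx₁, x₂, hx₂, hx⟩ := one_lt_card.1 (show 1 < #(e.erase y) by
    rw [card_erase_of_mem hy]; omega)
  set R := ((e.erase y).erase x₁).erase x₂ with hRdef
  have hx₂' : x₂ ∈ (e.erase y).erase x₁ := mem_erase.2 ⟨hx.symm, hx₂⟩
  have hRc : #R + 3 = #e := by
    rw [hRdef, card_erase_of_mem hx₂', card_erase_of_mem hx₁, card_erase_of_mem hy]; omega
  have hyx₁ : y ≠ x₁ := (mem_erase.1 hx₁).1.symm
  have hyx₂ : y ≠ x₂ := (mem_erase.1 hx₂).1.symm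
  have hR : ∀ v ∈ R, v ≠ y ∧ v ≠ x₁ ∧ v ≠ x₂ := fun v hv => by
    simp only [hRdef, mem_erase] at hv; tauto
  have he : ∀ v, v ∈ e ↔ v = x₁ ∨ v = x₂ ∨ v = y ∨ v ∈ R := fun v => by
    simp only [hRdef, mem_erase] at *
    by_cases h1 : v = x₁ <;> by_cases h2 : v = x₂ <;> by_cases h3 : v = y <;>
      simp_all
  obtain ⟨b, γ, hbγ⟩ := exists_mixed_difference_le hr R (by omega) (by omega)
  set θ : Fin r → ℝ := signed ⟨1, hr⟩ b with hθ
  set φ : Fin r → ℝ := signed ⟨0, by omega⟩ ⟨1, hr⟩ with hφ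
  set q : (V → Fin r) → ℝ := fun c => if ∀ v ∈ R, c v = γ v then 1 else 0 with hq
  have hqx : ∀ x ∉ R, ConstAt x q := fun x hxR => ConstAt.of_eq fun c c' hcc => by
    have : (∀ v ∈ R, c v = γ v) ↔ ∀ v ∈ R, c' v = γ v := forall_congr' fun v =>
      forall_congr' fun hv => by rw [hcc v fun hvx => hxR (hvx ▸ hv)]
    simp only [hq, this]
  have hθx : ∀ u x : V, x ≠ u → ConstAt x fun c : V → Fin r => θ (c u) := fun u x hxu =>
    ConstAt.of_eq fun c c' hcc => by rw [hcc u hxu.symm]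
  have hθm : ∀ u : V, MeanZeroAt u fun c : V → Fin r => θ (c u) := fun u c => by
    simp only [Function.update_self]
    exact sum_signed _ _
  have hx₁R : x₁ ∉ R := fun hm => (hR _ hm).2.1 rfl
  have hx₂R : x₂ ∉ R := fun hm => (hR _ hm).2.2 rfl
  have hyR : y ∉ R := fun hm => (hR _ hm).1 rfl
  have hq01 : ∀ c, 0 ≤ q c ∧ q c ≤ 1 := fun c => by
    simp only [hq]; split_ifs <;> norm_num
  refine ⟨fun c => θ (c x₁) * (θ (c x₂) * -q c), x₁, x₂, hx, hx₁, hx₂,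
    (hθm x₁).mul ((hθx x₂ x₁ hx).mul ((hqx x₁ hx₁R).comp fun z => -z)), ?_, ?_, ?_, ?_⟩
  · have h1 : MeanZeroAt x₂ fun c => θ (c x₂) * (θ (c x₁) * -q c) :=
      (hθm x₂).mul ((hθx x₁ x₂ hx.symm).mul ((hqx x₂ hx₂R).comp fun z => -z))
    intro c
    rw [← h1 c]
    exact sum_congr rfl fun a _ => by ring
  · intro x hxe
    have h1 : x ≠ x₁ := fun hh => hxe (hh ▸ hx₁)
    have h2 : x ≠ x₂ := fun hh => hxe (hh ▸ hx₂)
    have h3 : x ∉ R := fun hh => hxe (mem_of_mem_erase (mem_of_mem_erase hh))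
    exact (hθx x₁ x h1).mul ((hθx x₂ x h2).mul ((hqx x h3).comp fun z => -z))
  · intro c
    rw [abs_mul, abs_mul, abs_neg, abs_of_nonneg (hq01 c).1]
    exact mul_le_one₀ (abs_signed_le_one _ _ _) (mul_nonneg (abs_nonneg _) (hq01 c).1)
      (mul_le_one₀ (abs_signed_le_one _ _ _) (hq01 c).1 (hq01 c).2)
  · -- Average over the colours of `x₁`, `x₂` and `y` given the colours on `R`.
    have hr0 : (0 : ℝ) < r := by positivity
    set G : (V → Fin r) → ℝ := fun c =>
      θ (c x₁) * (θ (c x₂) * -q c) * (φ (c y) * rainbow e c) with hG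
    have hupd : ∀ c s t u, G (Function.update (Function.update (Function.update c x₁ s) x₂ t) y u)
        = -q c * (θ s * (θ t * (φ u * if Completes R γ s t u then 1 else 0))) := by
      intro c s t u
      set c' := Function.update (Function.update (Function.update c x₁ s) x₂ t) y u with hc'
      have e1 : c' x₁ = s := by simp [hc', hyx₁.symm, hx]
      have e2 : c' x₂ = t := by simp [hc', hyx₂.symm]
      have e3 : c' y = u := by simp [hc']
      have e4 : q c' = q c := by
        rw [hc', hqx y hyR, hqx x₂ hx₂R, hqx x₁ hx₁R]
      have e5 : ∀ v ∈ R, c' v = c v := fun v hv => by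
        simp [hc', (hR v hv).1, (hR v hv).2.1, (hR v hv).2.2]
      simp only [hG, e1, e2, e3, e4]
      by_cases hc : ∀ v ∈ R, c v = γ v
      · have e6 : (∀ i, ∃ v ∈ e, c' v = i) ↔ Completes R γ s t u := by
          refine forall_congr' fun i => ?_
          simp only [he]
          constructor
          · rintro ⟨v, rfl | rfl | rfl | hv, rfl⟩
            · exact Or.inl e1
            · exact Or.inr (Or.inl e2)
            · exact Or.inr (Or.inr (Or.inl e3))
            · exact Or.inr (Or.inr (Or.inr ⟨v, hv, by rw [e5 v hv, hc v hv]⟩))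
          · rintro (rfl | rfl | rfl | ⟨v, hv, rfl⟩)
            · exact ⟨x₁, by simp, e1⟩
            · exact ⟨x₂, by simp, e2⟩
            · exact ⟨y, by simp, e3⟩
            · exact ⟨v, by simp [hv], by rw [e5 v hv, hc v hv]⟩
        simp only [rainbow, e6]
        ring
      · have : q c = 0 := if_neg hc
        simp [this]
    have hav : 𝔼 c, G c = 𝔼 c, 𝔼 s, 𝔼 t, 𝔼 u,
        G (Function.update (Function.update (Function.update c x₁ s) x₂ t) y u) := by
      rw [expect_update x₁ fun c => 𝔼 t, 𝔼 u, G (Function.update (Function.update c x₂ t) y u),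
        expect_update x₂ fun c => 𝔼 u, G (Function.update c y u), expect_update y]
    change _ ≤ 𝔼 c, G c
    rw [hav]
    have hcyl := expect_cylinder R γ
    rw [Fintype.card_fin] at hcyl
    have h3 : 1 / (r : ℝ) ^ #e = 𝔼 c, q c * (1 / (r : ℝ) ^ 3) := by
      rw [← expect_mul, ← hRc, pow_add, hq, hcyl]
      field_simp
    rw [h3]
    refine expect_le_expect fun c _ => ?_
    simp only [hupd, ← mul_expect]
    simp only [Fintype.expect_eq_sum_div_card, Fintype.card_fin]
    simp only [← mul_div_assoc, ← sum_div]
    rw [show ∀ z : ℝ, -q c * z / r / r / r = q c * (-z / (r : ℝ) ^ 3) from fun z => by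
      field_simp]
    rw [mul_div_assoc (q c) 1]
    refine mul_le_mul_of_nonneg_left ?_ (hq01 c).1
    gcongr
    linarith

end TestFunction
/-! ### Biased colourings -/

section Bias

variable {V ι : Type*} [DecidableEq V] {r : ℕ}

lemma constAt_eval {K 𝕜 : Type*} (g : K → 𝕜) {v x : V} (h : x ≠ v) :
    ConstAt x fun c : V → K => g (c v) :=
  ConstAt.of_eq fun c c' hc => by rw [hc v h.symm]

lemma constAt_prod_signed_mul_rainbow (i j : Fin r) {A s : Finset V} (hA : A ⊆ s) {x : V}
    (hx : x ∉ s) :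
    ConstAt x fun c : V → Fin r => (∏ v ∈ A, signed i j (c v)) * rainbow s c := by
  have h1 : ConstAt x fun c : V → Fin r => ∏ v ∈ A, signed i j (c v) :=
    ConstAt.prod (F := fun v (c : V → Fin r) => signed i j (c v)) fun v hv =>
      constAt_eval (signed i j) fun h : x = v => hx (h ▸ hA hv)
  exact h1.mul (constAt_rainbow hx)

lemma meanZeroAt_signed {K : Type*} [DecidableEq K] [Fintype K] (i j : K) (v : V) :
    MeanZeroAt v fun c : V → K => signed i j (c v) := fun c => by
  simp only [Function.update_self]
  exact sum_signed i j

/-- If the colour of each `v ∈ Y` is biased by `s v`, where `s v` depends on the colours outside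
`Y` only, then only the biases in `E` matter to a function of the colours outside `Y \ E`. -/
lemma expect_prod_bias_mul {K : Type*} [DecidableEq K] [Fintype K] [Nonempty K] [Fintype V]
    (i j : K) (Y E : Finset V) (s : V → (V → K) → ℝ)
    (hs : ∀ v ∈ Y, ∀ x ∈ Y, ConstAt x (s v)) (F : (V → K) → ℝ)
    (hF : ∀ x ∈ Y, x ∉ E → ConstAt x F) :
    𝔼 c, (∏ v ∈ Y, (1 + s v c * signed i j (c v))) * F c
      = ∑ A ∈ (E ∩ Y).powerset, 𝔼 c, (∏ v ∈ A, s v c * signed i j (c v)) * F c := by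
  have hconst : ∀ x ∈ Y, ∀ v ∈ Y, v ≠ x → ConstAt x fun c => s v c * signed i j (c v) :=
    fun x hx v hv hvx => (hs v hv x hx).mul (constAt_eval _ hvx.symm)
  have h1 := expect_mul_prod_one_add_eq
    (fun c => F c * ∏ v ∈ E ∩ Y, (1 + s v c * signed i j (c v)))
    (fun v c => s v c * signed i j (c v)) (Y \ E) id ?_ ?_ ?_
  · rw [← expect_sum_comm]
    have h2 : ∀ c, (∏ v ∈ Y, (1 + s v c * signed i j (c v)))
        = (∏ v ∈ E ∩ Y, (1 + s v c * signed i j (c v)))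
          * ∏ v ∈ Y \ E, (1 + s v c * signed i j (c v)) := fun c => by
      rw [inter_comm, prod_inter_mul_prod_sdiff]
    calc _ = 𝔼 c, F c * (∏ v ∈ E ∩ Y, (1 + s v c * signed i j (c v)))
          * ∏ v ∈ Y \ E, (1 + s v c * signed i j (c v)) :=
          expect_congr rfl fun c _ => by rw [h2 c]; ring
      _ = _ := h1
      _ = _ := expect_congr rfl fun c _ => by rw [prod_one_add, mul_comm, sum_mul]
  · intro v hv
    have h3 := (meanZeroAt_signed i j v).mul (hs v (mem_sdiff.1 hv).1 v (mem_sdiff.1 hv).1)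
    intro c
    rw [← h3 c]
    exact sum_congr rfl fun a _ => mul_comm _ _
  · intro x hx
    rw [mem_sdiff] at hx
    exact (hF x hx.1 hx.2).mul (ConstAt.prod fun v hv =>
      (hconst x hx.1 v (mem_inter.1 hv).2 fun h => hx.2 (h ▸ (mem_inter.1 hv).1)).comp
        fun z => 1 + z)
  · intro x hx v hv hvx
    exact hconst x (mem_sdiff.1 hx).1 v (mem_sdiff.1 hv).1 hvx

/-- Test functions for the hyperedges `e f` that meet `Y` in a single vertex, whose colour is to be
chosen after the colours outside `Y`. The test function `ψ f` depends on the colours of the other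
vertices of `e f`, averages to zero over each of the vertices `x₁ f` and `x₂ f`, and
correlates with the gain from the colour `0` rather than `1` for the vertex in `Y`. -/
structure TestFamily [Fintype V] (e : ι → Finset V) (Y : Finset V) (hr : 2 ≤ r) where
  /-- The test functions. -/
  ψ : ι → (V → Fin r) → ℝ
  /-- A vertex whose colour averages out. -/
  x₁ : ι → V
  /-- Another vertex whose colour averages out. -/
  x₂ : ι → V
  ne : ∀ f v, e f ∩ Y = {v} → x₁ f ≠ x₂ f
  mem₁ : ∀ f v, e f ∩ Y = {v} → x₁ f ∈ e f \ Y
  mem₂ : ∀ f v, e f ∩ Y = {v} → x₂ f ∈ e f \ Y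
  meanZero₁ : ∀ f v, e f ∩ Y = {v} → MeanZeroAt (x₁ f) (ψ f)
  meanZero₂ : ∀ f v, e f ∩ Y = {v} → MeanZeroAt (x₂ f) (ψ f)
  constAt : ∀ f v, e f ∩ Y = {v} → ∀ x ∉ e f \ Y, ConstAt x (ψ f)
  abs_le_one : ∀ f v, e f ∩ Y = {v} → ∀ c, |ψ f c| ≤ 1
  gain : ∀ f v, e f ∩ Y = {v} → 1 / (r : ℝ) ^ #(e f) ≤
    𝔼 c, ψ f c * (signed ⟨0, by omega⟩ ⟨1, hr⟩ (c v) * rainbow (e f) c)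

lemma exists_testFamily [Fintype V] (e : ι → Finset V) (Y : Finset V) (hr : 2 ≤ r)
    (hrk : ∀ f, r ≤ #(e f)) (h : ∀ f, 4 ≤ #(e f) ∨ 3 ≤ r) : Nonempty (TestFamily e Y hr) := by
  have key : ∀ f, ∃ (ψ : (V → Fin r) → ℝ) (x₁ x₂ : V), ∀ v, e f ∩ Y = {v} →
      x₁ ≠ x₂ ∧ x₁ ∈ e f \ Y ∧ x₂ ∈ e f \ Y ∧
      MeanZeroAt x₁ ψ ∧ MeanZeroAt x₂ ψ ∧ (∀ x ∉ e f \ Y, ConstAt x ψ) ∧ (∀ c, |ψ c| ≤ 1) ∧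
      1 / (r : ℝ) ^ #(e f) ≤
        𝔼 c, ψ c * (signed ⟨0, by omega⟩ ⟨1, hr⟩ (c v) * rainbow (e f) c) := by
    intro f
    by_cases hv : ∃ v, e f ∩ Y = {v}
    · obtain ⟨v, hv⟩ := hv
      have hve : v ∈ e f := (mem_inter.1 (hv ▸ mem_singleton_self v)).1
      obtain ⟨ψ, x₁, x₂, hψ⟩ := exists_testFunction (e f) hve hr (hrk f) (h f)
      refine ⟨ψ, x₁, x₂, fun v' hv' => ?_⟩
      obtain rfl : v = v' := singleton_injective (hv.symm.trans hv')
      rwa [← sdiff_inter_self_left, hv, sdiff_singleton_eq_erase]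
    · obtain ⟨x, -⟩ : (e f).Nonempty := card_pos.1 (by have := hrk f; omega)
      exact ⟨fun _ => 0, x, x, fun v hv' => (hv ⟨v, hv'⟩).elim⟩
  choose ψ x₁ x₂ hψ using key
  refine ⟨⟨ψ, x₁, x₂, fun f v hv => (hψ f v hv).1, fun f v hv => (hψ f v hv).2.1,
    fun f v hv => (hψ f v hv).2.2.1, fun f v hv => (hψ f v hv).2.2.2.1,
    fun f v hv => (hψ f v hv).2.2.2.2.1, fun f v hv => (hψ f v hv).2.2.2.2.2.1,
    fun f v hv => (hψ f v hv).2.2.2.2.2.2.1, fun f v hv => (hψ f v hv).2.2.2.2.2.2.2⟩⟩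

end Bias

/-! ### Riesz products -/

section Riesz

open Complex

lemma norm_one_add_mul_I_mul_le {t x : ℝ} (hx : |x| ≤ 1) : ‖1 + t * I * x‖ ≤ 1 + t ^ 2 := by
  have h1 : ‖1 + t * I * x‖ ^ 2 = 1 + t ^ 2 * x ^ 2 := by
    rw [Complex.sq_norm, Complex.normSq_apply]
    simp
    ring
  have h2 : x ^ 2 ≤ 1 := (sq_le_one_iff_abs_le_one x).2 hx
  refine (sq_le_sq₀ (norm_nonneg _) (by positivity)).1 ?_
  nlinarith [sq_nonneg t, mul_le_mul_of_nonneg_left h2 (sq_nonneg t), sq_nonneg (t ^ 2)]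

/-- The factors of a Riesz product with purely imaginary coefficients deviate from modulus one to
second order only. -/
lemma norm_prod_one_add_mul_I_mul_le {ι : Type*} (S : Finset ι) (t x : ι → ℝ) {lam N : ℝ}
    (ht : ∀ f ∈ S, t f ^ 2 = lam ^ 2) (hx : ∀ f ∈ S, |x f| ≤ 1) (hS : (#S : ℝ) ≤ N)
    (hN : lam ^ 2 * N ≤ 1 / 2) : ‖∏ f ∈ S, (1 + t f * I * x f)‖ ≤ 2 := by
  rw [norm_prod]
  calc ∏ f ∈ S, ‖1 + t f * I * x f‖ ≤ ∏ f ∈ S, Real.exp (lam ^ 2) := by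
        refine prod_le_prod (fun f _ => norm_nonneg _) fun f hf => ?_
        refine (norm_one_add_mul_I_mul_le (hx f hf)).trans ?_
        rw [ht f hf, add_comm]
        exact Real.add_one_le_exp _
    _ = Real.exp (#S * lam ^ 2) := by rw [prod_const, Real.exp_nat_mul]
    _ ≤ Real.exp (1 / 2) := by
        gcongr
        nlinarith [mul_le_mul_of_nonneg_left hS (sq_nonneg lam)]
    _ ≤ 1 / (1 - 1 / 2) := Real.exp_bound_div_one_sub_of_interval (by norm_num) (by norm_num)
    _ = 2 := by norm_num

lemma meanZeroAt_mul_ofReal {V K : Type*} [DecidableEq V] [Fintype K] {x : V} {F : (V → K) → ℝ}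
    (hF : MeanZeroAt x F) (a : ℂ) : MeanZeroAt x fun c => a * (F c : ℂ) := fun c => by
  rw [← mul_sum, ← ofReal_sum, hF c, ofReal_zero, mul_zero]

variable {V ι : Type*} [DecidableEq V] [Fintype ι] {r : ℕ} {hr : 2 ≤ r}
  {e : ι → Finset V} {Y : Finset V}

/-- The hyperedges whose only vertex in `Y` is `v`. -/
def privateEdges (e : ι → Finset V) (Y : Finset V) (v : V) : Finset ι :=
  univ.filter fun f => e f ∩ Y = {v}

lemma mem_privateEdges {v : V} {f : ι} : f ∈ privateEdges e Y v ↔ e f ∩ Y = {v} := by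
  simp [privateEdges]

lemma mem_of_mem_privateEdges {v : V} {f : ι} (h : f ∈ privateEdges e Y v) : v ∈ e f ∧ v ∈ Y :=
  mem_inter.1 (mem_privateEdges.1 h ▸ mem_singleton_self v)

/-- Distinct hyperedges share at most one vertex. -/
def Linear (e : ι → Finset V) : Prop :=
  ∀ f g, f ≠ g → ∀ u v, u ∈ e f → u ∈ e g → v ∈ e f → v ∈ e g → u = v

lemma Linear.notMem_of_mem_privateEdges (hlin : Linear e) {v x : V} {f g : ι}
    (hf : f ∈ privateEdges e Y v) (hg : v ∈ e g) (hfg : f ≠ g) (hx : x ∈ e f \ Y) : x ∉ e g := by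
  intro hxg
  obtain ⟨hv, hvY⟩ := mem_of_mem_privateEdges hf
  rw [mem_sdiff] at hx
  exact hx.2 (hlin f g hfg v x hv hg hx.1 hxg ▸ hvY)

variable [Fintype V] (Ψ : TestFamily e Y hr)

/-- The Riesz product of the test functions of the hyperedges whose only vertex in `Y` is `v`. -/
noncomputable def TestFamily.riesz (t : ℝ) (v : V) (c : V → Fin r) : ℂ :=
  ∏ f ∈ privateEdges e Y v, (1 + t * I * Ψ.ψ f c)

/-- The bias towards colour `0` and against colour `1` of the colour of `v ∈ Y`. Its first order
term is `lam / 2` times the sum of the test functions; in contrast to that sum, it is bounded. -/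
noncomputable def TestFamily.bias (lam : ℝ) (v : V) (c : V → Fin r) : ℝ :=
  (Ψ.riesz lam v c).im / 2

lemma TestFamily.constAt_factor {f : ι} {v x : V} (hf : f ∈ privateEdges e Y v) (hx : x ∉ e f \ Y)
    (t : ℝ) : ConstAt x fun c => (1 + t * I * Ψ.ψ f c : ℂ) :=
  (Ψ.constAt f v (mem_privateEdges.1 hf) x hx).comp fun z : ℝ => (1 + t * I * z : ℂ)

lemma TestFamily.constAt_bias (lam : ℝ) (v : V) {x : V} (hx : x ∈ Y) :
    ConstAt x (Ψ.bias lam v) := by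
  have h : ConstAt x (Ψ.riesz lam v) := ConstAt.prod fun f hf =>
    Ψ.constAt_factor hf (fun hm => (mem_sdiff.1 hm).2 hx) lam
  exact h.comp fun z : ℂ => z.im / 2

lemma TestFamily.abs_bias_le_one {lam N : ℝ} {v : V} (hd : (#(privateEdges e Y v) : ℝ) ≤ N)
    (hN : lam ^ 2 * N ≤ 1 / 2) (c : V → Fin r) : |Ψ.bias lam v c| ≤ 1 := by
  have h1 := norm_prod_one_add_mul_I_mul_le (privateEdges e Y v) (fun _ => lam)
    (fun f => Ψ.ψ f c) (fun _ _ => rfl)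
    (fun f hf => Ψ.abs_le_one f v (mem_privateEdges.1 hf) c) hd hN
  have h2 := (abs_im_le_norm _).trans h1
  rw [TestFamily.bias, TestFamily.riesz, abs_div, abs_two]
  linarith

lemma im_expect {α : Type*} [Fintype α] (F : α → ℂ) : (𝔼 c, F c).im = 𝔼 c, (F c).im := by
  rw [Fintype.expect_eq_sum_div_card, Fintype.expect_eq_sum_div_card, div_natCast_im, im_sum]

lemma ofReal_expect {α : Type*} [Fintype α] (F : α → ℝ) :
    ((𝔼 c, F c : ℝ) : ℂ) = 𝔼 c, (F c : ℂ) := by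
  rw [Fintype.expect_eq_sum_div_card, Fintype.expect_eq_sum_div_card]
  push_cast
  rfl

lemma TestFamily.expect_bias_mul (lam : ℝ) (v : V) (G : (V → Fin r) → ℝ) :
    𝔼 c, Ψ.bias lam v c * G c = (𝔼 c, (G c : ℂ) * Ψ.riesz lam v c).im / 2 := by
  rw [im_expect, expect_div]
  refine expect_congr rfl fun c _ => ?_
  rw [im_ofReal_mul, TestFamily.bias]
  ring

variable [DecidableEq ι]

/-- Let `v` be a vertex of the hyperedge `e g`. The other hyperedges through `v` do not
contribute to the correlation of the Riesz product at `v` with a function of the colours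
on `e g`. -/
lemma TestFamily.expect_mul_prod_erase (hlin : Linear e) (t : ℝ) {g : ι} {v : V} (hv : v ∈ e g)
    (F : (V → Fin r) → ℂ) (hF : ∀ x ∉ e g, ConstAt x F) :
    𝔼 c, F c * ∏ f ∈ (privateEdges e Y v).erase g, (1 + t * I * Ψ.ψ f c) = 𝔼 c, F c := by
  have : NeZero r := ⟨by omega⟩
  refine expect_mul_prod_one_add_eq F (fun f c => t * I * Ψ.ψ f c)
    ((privateEdges e Y v).erase g) Ψ.x₁ (fun f hf => ?_) (fun f hf => ?_) fun f hf l hl hlf => ?_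
  all_goals
    obtain ⟨hfg, hf⟩ := mem_erase.1 hf
    have hf' := mem_privateEdges.1 hf
  · exact meanZeroAt_mul_ofReal (Ψ.meanZero₁ f v hf') _
  · exact hF _ (hlin.notMem_of_mem_privateEdges hf hv hfg (Ψ.mem₁ f v hf'))
  · have hl := mem_of_mem_erase hl
    refine (Ψ.constAt l v (mem_privateEdges.1 hl) _ fun hm => ?_).comp fun z : ℝ => (t * I * z : ℂ)
    exact hlin.notMem_of_mem_privateEdges hf (mem_of_mem_privateEdges hl).1 hlf.symm
      (Ψ.mem₁ f v hf') (mem_sdiff.1 hm).1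

lemma TestFamily.expect_bias_mul_of_mem (hlin : Linear e) (lam : ℝ) {g : ι} {v : V}
    (hg : g ∈ privateEdges e Y v) (G : (V → Fin r) → ℝ) (hG : ∀ x ∉ e g, ConstAt x G) :
    𝔼 c, Ψ.bias lam v c * G c = lam / 2 * 𝔼 c, Ψ.ψ g c * G c := by
  have h := Ψ.expect_mul_prod_erase hlin lam (mem_of_mem_privateEdges hg).1
    (fun c => (G c : ℂ) * (1 + lam * I * Ψ.ψ g c)) fun x hx =>
      ((hG x hx).comp ofReal).mul (Ψ.constAt_factor hg (fun hm => hx (mem_sdiff.1 hm).1) lam)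
  have h2 : 𝔼 c, (G c : ℂ) * Ψ.riesz lam v c = 𝔼 c, (G c : ℂ) * (1 + lam * I * Ψ.ψ g c) := by
    rw [← h]
    refine expect_congr rfl fun c _ => ?_
    rw [TestFamily.riesz, ← mul_prod_erase _ _ hg]
    exact (mul_assoc _ _ _).symm
  rw [Ψ.expect_bias_mul, h2, im_expect, mul_expect, expect_div]
  refine expect_congr rfl fun c _ => ?_
  simp
  ring

lemma TestFamily.expect_bias_mul_of_notMem (hlin : Linear e) (lam : ℝ) {g : ι} {v : V}
    (hv : v ∈ e g) (hg : g ∉ privateEdges e Y v) (G : (V → Fin r) → ℝ)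
    (hG : ∀ x ∉ e g, ConstAt x G) :
    𝔼 c, Ψ.bias lam v c * G c = 0 := by
  have h := Ψ.expect_mul_prod_erase hlin lam hv (fun c => (G c : ℂ)) fun x hx =>
    (hG x hx).comp ofReal
  rw [erase_eq_of_notMem hg] at h
  rw [Ψ.expect_bias_mul]
  simp only [TestFamily.riesz]
  rw [h, ← ofReal_expect, ofReal_im, zero_div]

/-- The biases of several vertices of one hyperedge are nearly uncorrelated.

The imaginary part of a Riesz product is a difference of two Riesz products with opposite signs.
Multiplying out, every product of Riesz products has nearly the same mean, whatever the signs, and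
these means cancel. -/
lemma TestFamily.abs_expect_prod_bias_mul_le (hlin : Linear e) {lam N : ℝ} {k : ℕ} (hlam : 0 ≤ lam)
    (hN : lam ^ 2 * (k * N) ≤ 1 / 2) {g : ι} {A : Finset V} (hA : A ⊆ e g ∩ Y) (hA2 : 2 ≤ #A)
    (hAk : #A ≤ k) (hd : ∀ v ∈ A, (#(privateEdges e Y v) : ℝ) ≤ N)
    (G : (V → Fin r) → ℝ) (hG1 : ∀ c, |G c| ≤ 1) (hG : ∀ x ∉ e g, ConstAt x G) :
    |𝔼 c, (∏ v ∈ A, Ψ.bias lam v c) * G c| ≤ k * N * (k * (k * (lam ^ 3 * 2))) := by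
  have : NeZero r := ⟨by omega⟩
  have hAe : ∀ v ∈ A, v ∈ e g := fun v hv => (mem_inter.1 (hA hv)).1
  have hAY : ∀ v ∈ A, v ∈ Y := fun v hv => (mem_inter.1 (hA hv)).2
  set T : Finset ι := A.biUnion (privateEdges e Y) with hT
  have hTmem : ∀ f, f ∈ T ↔ ∃ v ∈ A, f ∈ privateEdges e Y v := fun f => by simp [hT]
  have hdisj : (A : Set V).PairwiseDisjoint (privateEdges e Y) := by
    intro u _ v _ huv
    refine disjoint_left.2 fun f hfu hfv => huv ?_
    exact singleton_injective ((mem_privateEdges.1 hfu).symm.trans (mem_privateEdges.1 hfv))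
  have hN0 : 0 ≤ N := by
    obtain ⟨v, hv⟩ : A.Nonempty := card_pos.1 (by omega)
    exact (Nat.cast_nonneg _).trans (hd v hv)
  have hTc : (#T : ℝ) ≤ k * N := by
    calc (#T : ℝ) = ∑ v ∈ A, (#(privateEdges e Y v) : ℝ) := by
          rw [hT, card_biUnion hdisj]; push_cast; rfl
      _ ≤ #A * N := by
          rw [← nsmul_eq_mul]; exact sum_le_card_nsmul _ _ _ hd
      _ ≤ k * N := by gcongr
  have hTg : ∀ f ∈ T, f ≠ g := by
    rintro f hf rfl
    obtain ⟨v, -, hv⟩ := (hTmem f).1 hf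
    have := card_le_card hA
    rw [mem_privateEdges.1 hv, card_singleton] at this
    omega
  -- The correlation with a product of Riesz products with arbitrary signs.
  have main : ∀ t : ι → ℝ, (∀ f, t f ^ 2 = lam ^ 2) →
      ‖𝔼 c, (G c : ℂ) * ∏ f ∈ T, (1 + t f * I * Ψ.ψ f c) - 𝔼 c, (G c : ℂ)‖
        ≤ k * N * (k * (k * (lam ^ 3 * 2))) := by
    intro t ht
    have habs : ∀ f, |t f| = lam := fun f => by
      rw [← abs_of_nonneg hlam]; exact (sq_eq_sq_iff_abs_eq_abs _ _).1 (ht f)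
    refine (norm_expect_mul_prod_one_add_sub_le (fun c => (G c : ℂ))
      (fun f c => t f * I * Ψ.ψ f c) T (fun f => e f \ Y) Ψ.x₁ Ψ.x₂ (lam := lam) (B := 2) (D := k)
      hlam (fun c => ?_) (fun f hf c => ?_) (fun S hS c => ?_) (fun f hf x hx => ?_)
      (fun f hf x hx => ?_) (fun f hf => ?_) (fun f hf => ?_) (fun f hf => ?_) (fun f hf => ?_)
      (fun f hf => ?_) (fun f hf l hl hfl u hu hu' v hv hv' => ?_) fun x => ?_).trans ?_
    · rw [norm_real, Real.norm_eq_abs]; exact hG1 c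
    · obtain ⟨v, -, hv⟩ := (hTmem f).1 hf
      rw [norm_mul, norm_mul, norm_real, norm_real, norm_I, Real.norm_eq_abs, Real.norm_eq_abs,
        habs f, mul_one]
      exact mul_le_of_le_one_right hlam (Ψ.abs_le_one f v (mem_privateEdges.1 hv) c)
    · refine norm_prod_one_add_mul_I_mul_le S t (fun f => Ψ.ψ f c) (fun f _ => ht f)
        (fun f hf => ?_) ((Nat.cast_le.2 (card_le_card hS)).trans hTc) hN
      obtain ⟨v, -, hv⟩ := (hTmem f).1 (hS hf)
      exact Ψ.abs_le_one f v (mem_privateEdges.1 hv) c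
    · obtain ⟨v, hvA, hv⟩ := (hTmem f).1 hf
      exact (hG x (hlin.notMem_of_mem_privateEdges hv (hAe v hvA) (hTg f hf) hx)).comp ofReal
    · obtain ⟨v, -, hv⟩ := (hTmem f).1 hf
      exact (Ψ.constAt f v (mem_privateEdges.1 hv) x hx).comp fun z : ℝ => (t f * I * z : ℂ)
    · obtain ⟨v, -, hv⟩ := (hTmem f).1 hf
      exact Ψ.mem₁ f v (mem_privateEdges.1 hv)
    · obtain ⟨v, -, hv⟩ := (hTmem f).1 hf
      exact Ψ.mem₂ f v (mem_privateEdges.1 hv)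
    · obtain ⟨v, -, hv⟩ := (hTmem f).1 hf
      exact Ψ.ne f v (mem_privateEdges.1 hv)
    · obtain ⟨v, -, hv⟩ := (hTmem f).1 hf
      exact meanZeroAt_mul_ofReal (Ψ.meanZero₁ f v (mem_privateEdges.1 hv)) _
    · obtain ⟨v, -, hv⟩ := (hTmem f).1 hf
      exact meanZeroAt_mul_ofReal (Ψ.meanZero₂ f v (mem_privateEdges.1 hv)) _
    · exact hlin f l hfl u v (mem_sdiff.1 hu).1 (mem_sdiff.1 hu').1 (mem_sdiff.1 hv).1
        (mem_sdiff.1 hv').1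
    · -- For each `v ∈ A` at most one hyperedge contains both `v` and `x`.
      rw [hT, filter_biUnion]
      refine (card_biUnion_le_card_mul _ _ 1 fun v hv => ?_).trans (by simpa using hAk)
      refine card_le_one.2 fun f hf l hl => by_contra fun hfl => ?_
      rw [mem_filter] at hf hl
      exact hlin.notMem_of_mem_privateEdges hf.1 (mem_of_mem_privateEdges hl.1).1 hfl hf.2
        (mem_sdiff.1 hl.2).1
    · gcongr
  have hprod : ∀ c, ((∏ v ∈ A, Ψ.bias lam v c : ℝ) : ℂ) = (1 / (4 * I)) ^ #A *
      ∑ s ∈ A.powerset, (∏ v ∈ A \ s, (-1 : ℂ)) *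
        ((∏ v ∈ s, Ψ.riesz lam v c) * ∏ v ∈ A \ s, Ψ.riesz (-lam) v c) := by
    intro c
    have h1 : ∀ v, (Ψ.bias lam v c : ℂ)
        = 1 / (4 * I) * (Ψ.riesz lam v c + -1 * Ψ.riesz (-lam) v c) := by
      intro v
      have hconj : Ψ.riesz (-lam) v c = starRingEnd ℂ (Ψ.riesz lam v c) := by
        simp [TestFamily.riesz, map_prod]
      have h2 := sub_conj (Ψ.riesz lam v c)
      rw [hconj, TestFamily.bias, neg_one_mul, ← sub_eq_add_neg, h2]
      push_cast
      field_simp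
      norm_num
    push_cast
    simp only [h1]
    rw [prod_mul_distrib, prod_const, prod_add]
    congr 1
    refine sum_congr rfl fun s _ => ?_
    rw [prod_mul_distrib]
    ring
  have hsigns : ∀ s ⊆ A, ∀ c, (∏ v ∈ s, Ψ.riesz lam v c) * ∏ v ∈ A \ s, Ψ.riesz (-lam) v c
      = ∏ f ∈ T, (1 + (if ∃ v ∈ s, f ∈ privateEdges e Y v then lam else -lam : ℝ) * I
          * Ψ.ψ f c) := by
    intro s hs c
    rw [hT, prod_biUnion hdisj, ← prod_sdiff hs, mul_comm]
    congr 1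
    · refine prod_congr rfl fun v hv => prod_congr rfl fun f hf => ?_
      rw [if_neg]
      rintro ⟨u, hu, hfu⟩
      have huv : u = v :=
        singleton_injective ((mem_privateEdges.1 hfu).symm.trans (mem_privateEdges.1 hf))
      exact (mem_sdiff.1 hv).2 (huv ▸ hu)
    · refine prod_congr rfl fun v hv => prod_congr rfl fun f hf => ?_
      rw [if_pos ⟨v, hv, hf⟩]
  have hcancel : ∑ s ∈ A.powerset, ∏ v ∈ A \ s, (-1 : ℂ) = 0 := by
    have h1 := prod_add (fun _ : V => (1 : ℂ)) (fun _ => -1) A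
    simp only [prod_const_one, one_mul, add_neg_cancel, prod_const] at h1 ⊢
    rw [← h1, zero_pow (by omega)]
  have hexp : ((𝔼 c, (∏ v ∈ A, Ψ.bias lam v c) * G c : ℝ) : ℂ) = (1 / (4 * I)) ^ #A *
      ∑ s ∈ A.powerset, (∏ v ∈ A \ s, (-1 : ℂ)) *
        (𝔼 c, (G c : ℂ) * ∏ f ∈ T, (1 + (if ∃ v ∈ s, f ∈ privateEdges e Y v then lam else -lam : ℝ)
          * I * Ψ.ψ f c) - 𝔼 c, (G c : ℂ)) := by
    simp only [mul_sub, sum_sub_distrib]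
    rw [← sum_mul _ _ (𝔼 c, (G c : ℂ)), hcancel, zero_mul, mul_zero, sub_zero, ofReal_expect]
    simp only [mul_expect]
    rw [← expect_sum_comm, mul_expect]
    refine expect_congr rfl fun c _ => ?_
    rw [ofReal_mul, hprod, mul_assoc, sum_mul]
    congr 1
    refine sum_congr rfl fun s hs => ?_
    rw [hsigns s (mem_powerset.1 hs)]
    ring
  rw [← Real.norm_eq_abs, ← norm_real, hexp, norm_mul]
  set M : ℝ := k * N * (k * (k * (lam ^ 3 * 2))) with hM
  have hM0 : 0 ≤ M := by positivity
  have hsum : ‖∑ s ∈ A.powerset, (∏ v ∈ A \ s, (-1 : ℂ)) *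
        (𝔼 c, (G c : ℂ) * ∏ f ∈ T, (1 + (if ∃ v ∈ s, f ∈ privateEdges e Y v then lam else -lam : ℝ)
          * I * Ψ.ψ f c) - 𝔼 c, (G c : ℂ))‖ ≤ 2 ^ #A * M := by
    refine (norm_sum_le _ _).trans ((sum_le_card_nsmul _ _ M fun s _ => ?_).trans_eq ?_)
    · rw [norm_mul, norm_prod]
      simp only [norm_neg, norm_one, prod_const_one, one_mul]
      exact main _ fun f => by split_ifs <;> ring
    · rw [card_powerset, nsmul_eq_mul]
      push_cast
      rfl
  calc ‖(1 / (4 * I)) ^ #A‖ * _ ≤ (1 / 4) ^ #A * (2 ^ #A * M) := by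
        gcongr
        simp
    _ = (1 / 2) ^ #A * M := by
        rw [← mul_assoc, ← mul_pow]; norm_num
    _ ≤ 1 * M := by
        gcongr
        exact pow_le_one₀ (by norm_num) (by norm_num)
    _ = M := one_mul M

end Riesz
/-! ### The expected gain of a biased colouring -/

section Gain

variable {V ι : Type*} [DecidableEq V] [Fintype V] [Fintype ι] {r : ℕ} {hr : 2 ≤ r}
  {e : ι → Finset V} {Y : Finset V}

/-- The density of the random colouring in which the vertices of `Y` are coloured after all other
vertices, with the given biases, relative to a uniformly random colouring. -/
noncomputable def TestFamily.weight (Ψ : TestFamily e Y hr) (lam : ℝ) (c : V → Fin r) : ℝ :=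
  ∏ v ∈ Y, (1 + Ψ.bias lam v c * signed ⟨0, by omega⟩ ⟨1, hr⟩ (c v))

variable (Ψ : TestFamily e Y hr)

lemma TestFamily.weight_nonneg {lam N : ℝ} (hd : ∀ v ∈ Y, (#(privateEdges e Y v) : ℝ) ≤ N)
    (hN : lam ^ 2 * N ≤ 1 / 2) (c : V → Fin r) : 0 ≤ Ψ.weight lam c := by
  refine prod_nonneg fun v hv => ?_
  have h1 : |Ψ.bias lam v c * signed ⟨0, by omega⟩ ⟨1, hr⟩ (c v)| ≤ 1 := by
    rw [abs_mul]
    exact mul_le_one₀ (Ψ.abs_bias_le_one (hd v hv) hN c) (abs_nonneg _) (abs_signed_le_one _ _ _)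
  linarith [(abs_le.1 h1).1]

lemma TestFamily.expect_weight (lam : ℝ) : 𝔼 c, Ψ.weight lam c = 1 := by
  have : NeZero r := ⟨by omega⟩
  have h := expect_prod_bias_mul ⟨0, by omega⟩ ⟨1, hr⟩ Y ∅ (Ψ.bias lam)
    (fun v _ x hx => Ψ.constAt_bias lam v hx) (fun _ => 1) fun x _ _ _ _ => rfl
  simpa [TestFamily.weight] using h

lemma TestFamily.expect_weight_mul_rainbow (lam : ℝ) (f : ι) :
    𝔼 c, Ψ.weight lam c * rainbow (e f) c
      = ∑ A ∈ (e f ∩ Y).powerset, 𝔼 c, (∏ v ∈ A, Ψ.bias lam v c) *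
          ((∏ v ∈ A, signed ⟨0, by omega⟩ ⟨1, hr⟩ (c v)) * rainbow (e f) c) := by
  have : NeZero r := ⟨by omega⟩
  have h := expect_prod_bias_mul ⟨0, by omega⟩ ⟨1, hr⟩ Y (e f) (Ψ.bias lam)
    (fun v _ x hx => Ψ.constAt_bias lam v hx) (rainbow (e f)) fun x _ hx => constAt_rainbow hx
  simp only [prod_mul_distrib, mul_assoc] at h
  exact h

variable [DecidableEq ι]

lemma TestFamily.le_expect_weight_mul_rainbow_of_private (hlin : Linear e) {lam : ℝ}
    (hlam : 0 ≤ lam) {f : ι} (hf : #(e f ∩ Y) = 1) :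
    𝔼 c : V → Fin r, rainbow (e f) c + lam / 2 * (1 / (r : ℝ) ^ #(e f))
      ≤ 𝔼 c, Ψ.weight lam c * rainbow (e f) c := by
  obtain ⟨v, hv⟩ := card_eq_one.1 hf
  have hve : v ∈ e f := (mem_inter.1 (hv ▸ mem_singleton_self v)).1
  rw [Ψ.expect_weight_mul_rainbow, hv, ← insert_empty_eq, sum_powerset_insert (notMem_empty v)]
  simp only [powerset_empty, sum_singleton, prod_empty, one_mul, insert_empty_eq, prod_singleton]
  have hconst : ∀ x ∉ e f, ConstAt x fun c : V → Fin r =>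
      signed ⟨0, by omega⟩ ⟨1, hr⟩ (c v) * rainbow (e f) c := fun x hx => by
    simpa using constAt_prod_signed_mul_rainbow (⟨0, by omega⟩ : Fin r) ⟨1, hr⟩
      (singleton_subset_iff.2 hve) hx
  rw [Ψ.expect_bias_mul_of_mem hlin lam (mem_privateEdges.2 hv) _ hconst]
  gcongr
  exact Ψ.gain f v hv

lemma TestFamily.le_expect_weight_mul_rainbow (hlin : Linear e) {lam N : ℝ} {k : ℕ}
    (hlam : 0 ≤ lam) (hN0 : 0 ≤ N) (hN : lam ^ 2 * (k * N) ≤ 1 / 2)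
    (hd : ∀ v ∈ Y, (#(privateEdges e Y v) : ℝ) ≤ N) {f : ι} (hfk : #(e f) ≤ k)
    (hf : #(e f ∩ Y) ≠ 1) :
    𝔼 c : V → Fin r, rainbow (e f) c - 2 ^ k * (k * N * (k * (k * (lam ^ 3 * 2))))
      ≤ 𝔼 c, Ψ.weight lam c * rainbow (e f) c := by
  set M : ℝ := k * N * (k * (k * (lam ^ 3 * 2))) with hM
  have hM0 : 0 ≤ M := by positivity
  have hcard : #(e f ∩ Y) ≤ k := (card_le_card inter_subset_left).trans hfk
  have hterm : ∀ A ∈ (e f ∩ Y).powerset.erase ∅, -M ≤ 𝔼 c, (∏ v ∈ A, Ψ.bias lam v c) *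
      ((∏ v ∈ A, signed ⟨0, by omega⟩ ⟨1, hr⟩ (c v)) * rainbow (e f) c) := by
    intro A hA
    obtain ⟨hA0, hA⟩ := mem_erase.1 hA
    rw [mem_powerset] at hA
    have hG : ∀ x ∉ e f, ConstAt x fun c : V → Fin r =>
        (∏ v ∈ A, signed ⟨0, by omega⟩ ⟨1, hr⟩ (c v)) * rainbow (e f) c := fun x hx =>
      constAt_prod_signed_mul_rainbow _ _ (hA.trans inter_subset_left) hx
    rcases (Nat.one_le_iff_ne_zero.2 (card_ne_zero.2 (nonempty_iff_ne_empty.2 hA0))).eq_or_lt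
      with h1 | h2
    · obtain ⟨v, rfl⟩ := card_eq_one.1 h1.symm
      have hv : v ∈ e f := (mem_inter.1 (hA (mem_singleton_self v))).1
      have h0 := Ψ.expect_bias_mul_of_notMem hlin lam hv (fun hm => hf (by
        rw [mem_privateEdges.1 hm, card_singleton])) _ hG
      simp only [prod_singleton] at h0 ⊢
      rw [h0]
      linarith
    · refine (abs_le.1 (Ψ.abs_expect_prod_bias_mul_le hlin hlam hN hA h2
        ((card_le_card hA).trans hcard) (fun v hv => hd v (mem_inter.1 (hA hv)).2) _
        (fun c => ?_) hG)).1
      rw [abs_mul, abs_prod, abs_of_nonneg (rainbow_nonneg _ _)]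
      exact mul_le_one₀ (prod_le_one (fun _ _ => abs_nonneg _) fun _ _ => abs_signed_le_one _ _ _)
        (rainbow_nonneg _ _) (rainbow_le_one _ _)
  rw [Ψ.expect_weight_mul_rainbow, ← add_sum_erase _ _ (empty_mem_powerset (e f ∩ Y))]
  have hsum := card_nsmul_le_sum _ _ _ hterm
  have hc : (#((e f ∩ Y).powerset.erase ∅) : ℝ) ≤ 2 ^ k := by
    have h1 : #((e f ∩ Y).powerset.erase ∅) ≤ 2 ^ k :=
      (card_erase_le.trans (card_powerset _).le).trans (Nat.pow_le_pow_right (by norm_num) hcard)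
    exact_mod_cast h1
  rw [nsmul_eq_mul] at hsum
  simp only [prod_empty, one_mul]
  nlinarith [mul_le_mul_of_nonneg_right hc hM0]

/-- If the vertices of `Y` have bounded degree in the hyperedges meeting `Y` once, then some
colouring exceeds the mean number of hyperedges with all colours by a gain from each hyperedge
meeting `Y` once, up to a loss of smaller order from the other hyperedges. -/
lemma exists_coloring_of_private {k : ℕ} (hr : 2 ≤ r) (hrk : r ≤ k) (h : 4 ≤ k ∨ 3 ≤ r)
    (hcard : ∀ f, #(e f) = k) (hlin : Linear e) {lam N : ℝ} (hlam : 0 ≤ lam) (hN0 : 0 ≤ N)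
    (hN : lam ^ 2 * (k * N) ≤ 1 / 2) (hd : ∀ v ∈ Y, (#(privateEdges e Y v) : ℝ) ≤ N) :
    ∃ c : V → Fin r,
      #(univ.filter fun f => #(e f ∩ Y) = 1) * (lam / 2 * (1 / (r : ℝ) ^ k))
        - Fintype.card ι * (2 ^ k * (k * N * (k * (k * (lam ^ 3 * 2)))))
      ≤ ∑ f, rainbow (e f) c
        - Fintype.card ι * (Nat.stirlingSecond k r * r.factorial / (r : ℝ) ^ k) := by
  classical
  have : NeZero r := ⟨by omega⟩
  obtain ⟨Ψ⟩ := exists_testFamily e Y hr (fun f => hrk.trans (hcard f).ge)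
    fun f => by rw [hcard f]; exact h
  have hmean : ∀ f, 𝔼 c : V → Fin r, rainbow (e f) c
      = Nat.stirlingSecond k r * r.factorial / (r : ℝ) ^ k := fun f => by
    rw [expect_rainbow, hcard f, Fintype.card_fin]
  set μ : ℝ := Nat.stirlingSecond k r * r.factorial / (r : ℝ) ^ k with hμ
  set M : ℝ := 2 ^ k * (k * N * (k * (k * (lam ^ 3 * 2)))) with hM
  have hM0 : 0 ≤ M := by positivity
  have hN' : lam ^ 2 * N ≤ 1 / 2 := by
    refine le_trans ?_ hN
    have hk1 : (1 : ℝ) ≤ k := by exact_mod_cast (by omega : 1 ≤ k)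
    gcongr
    nlinarith
  obtain ⟨c₀, hc₀⟩ := Finite.exists_max fun c : V → Fin r => ∑ f, rainbow (e f) c
  refine ⟨c₀, ?_⟩
  have h1 : 𝔼 c, Ψ.weight lam c * ∑ f, rainbow (e f) c ≤ ∑ f, rainbow (e f) c₀ := by
    calc 𝔼 c, Ψ.weight lam c * ∑ f, rainbow (e f) c
        ≤ 𝔼 c, Ψ.weight lam c * ∑ f, rainbow (e f) c₀ := expect_le_expect fun c _ =>
          mul_le_mul_of_nonneg_left (hc₀ c) (Ψ.weight_nonneg hd hN' c)
      _ = ∑ f, rainbow (e f) c₀ := by rw [← expect_mul, Ψ.expect_weight, one_mul]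
  have h2 : ∑ f, (μ - M + if #(e f ∩ Y) = 1 then lam / 2 * (1 / (r : ℝ) ^ k) else 0)
      ≤ ∑ f, 𝔼 c, Ψ.weight lam c * rainbow (e f) c := by
    refine sum_le_sum fun f _ => ?_
    split_ifs with hf
    · have h3 := Ψ.le_expect_weight_mul_rainbow_of_private hlin hlam hf
      rw [hmean, hcard] at h3
      linarith
    · have h3 := Ψ.le_expect_weight_mul_rainbow hlin hlam hN0 hN hd (hcard f).le hf
      rw [hmean] at h3
      linarith
  rw [← expect_sum_comm] at h2
  simp only [← mul_sum] at h2
  rw [sum_add_distrib, sum_const, card_univ, nsmul_eq_mul, ← sum_filter, sum_const,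
    nsmul_eq_mul] at h2
  linarith

end Gain

/-! ### Vertices of small degree -/

section Degree

variable {V ι : Type*} [DecidableEq V] [Fintype ι] {e : ι → Finset V}

/-- Some subset of `L` meets a constant proportion of the hyperedges meeting `L` exactly once. -/
lemma exists_subset_card_inter_eq_one (e : ι → Finset V) {k : ℕ} (hcard : ∀ f, #(e f) ≤ k)
    (L : Finset V) : ∃ Y ⊆ L, #(univ.filter fun f => (e f ∩ L).Nonempty)
      ≤ 2 ^ k * #(univ.filter fun f => #(e f ∩ Y) = 1) := by
  classical
  by_contra! hcon
  set Gd := univ.filter fun f => (e f ∩ L).Nonempty with hGd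
  have h1 : ∑ Y ∈ L.powerset, 2 ^ k * #(univ.filter fun f => #(e f ∩ Y) = 1)
      < ∑ Y ∈ L.powerset, #Gd :=
    sum_lt_sum_of_nonempty (powerset_nonempty L) fun Y hY => hcon Y (mem_powerset.1 hY)
  have h2 : ∀ f ∈ Gd, 2 ^ #L ≤ 2 ^ k * #(L.powerset.filter fun Y => #(e f ∩ Y) = 1) := by
    intro f hf
    obtain ⟨v, hv⟩ := (mem_filter.1 hf).2
    rw [mem_inter] at hv
    -- Sets meeting `e f` in `v` only.
    have h3 : #((L \ e f).powerset) ≤ #(L.powerset.filter fun Y => #(e f ∩ Y) = 1) := by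
      have hvZ : ∀ Z ∈ (L \ e f).powerset, v ∉ Z := fun Z hZ hvZ =>
        (mem_sdiff.1 (mem_powerset.1 hZ hvZ)).2 hv.1
      refine card_le_card_of_injOn (insert v) (fun Z hZ => ?_) fun Z hZ Z' hZ' hZZ => ?_
      · rw [mem_coe] at hZ
        have hZ' := mem_powerset.1 hZ
        have hdisj : e f ∩ Z = ∅ := by
          rw [← disjoint_iff_inter_eq_empty]
          exact disjoint_left.2 fun x hx hxZ => (mem_sdiff.1 (hZ' hxZ)).2 hx
        rw [mem_coe, mem_filter, mem_powerset, inter_insert_of_mem hv.1, hdisj, insert_empty_eq,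
          card_singleton]
        exact ⟨insert_subset hv.2 (hZ'.trans sdiff_subset), rfl⟩
      · rw [← erase_insert (hvZ Z hZ), ← erase_insert (hvZ Z' hZ')]
        exact congrArg (fun s => s.erase v) hZZ
    rw [card_powerset] at h3
    calc 2 ^ #L ≤ 2 ^ (k + #(L \ e f)) := by
          refine Nat.pow_le_pow_right (by norm_num) ?_
          have := card_le_card_sdiff_add_card (s := L) (t := e f)
          have := hcard f
          omega
      _ ≤ _ := by rw [pow_add]; gcongr
  have h4 : ∑ Y ∈ L.powerset, #(univ.filter fun f => #(e f ∩ Y) = 1)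
      = ∑ f, #(L.powerset.filter fun Y => #(e f ∩ Y) = 1) := by
    simp only [card_filter]
    exact sum_comm
  rw [← mul_sum, h4, sum_const, card_powerset, smul_eq_mul] at h1
  have h5 := sum_le_sum h2
  rw [sum_const, smul_eq_mul, ← mul_sum, mul_comm] at h5
  have h6 : ∑ f ∈ Gd, #(L.powerset.filter fun Y => #(e f ∩ Y) = 1)
      ≤ ∑ f, #(L.powerset.filter fun Y => #(e f ∩ Y) = 1) :=
    sum_le_sum_of_subset (subset_univ Gd)
  have h7 := Nat.mul_le_mul_left (2 ^ k) h6
  omega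

variable [Fintype V]

/-- In a linear hypergraph, only few hyperedges consist of vertices of large degree. -/
lemma card_le_two_mul_card_inter_nonempty {k : ℕ} (hk : 2 ≤ k) (hcard : ∀ f, #(e f) = k)
    (hlin : Linear e) :
    Fintype.card ι ≤ 2 * #(univ.filter fun f => (e f ∩ univ.filter fun v =>
      (#(univ.filter fun g => v ∈ e g) : ℝ) ≤ 2 * k * √(Fintype.card ι)).Nonempty) := by
  classical
  set m := Fintype.card ι with hm
  set S : Finset V := univ.filter fun v =>
    ¬ (#(univ.filter fun g => v ∈ e g) : ℝ) ≤ 2 * k * √m with hS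
  set B : Finset ι := univ.filter fun f => e f ⊆ S with hB
  have hBS : #B ≤ #S * #S := by
    have h1 : ∀ f, ∃ p : V × V, p.1 ∈ e f ∧ p.2 ∈ e f ∧ p.1 ≠ p.2 := fun f => by
      obtain ⟨u, hu, v, hv, huv⟩ := one_lt_card.1 (show 1 < #(e f) by rw [hcard f]; omega)
      exact ⟨(u, v), hu, hv, huv⟩
    choose p hp1 hp2 hp using h1
    rw [← card_product]
    refine card_le_card_of_injOn p (fun f hf => ?_) fun f _ g _ hfg => ?_
    · have hfS : e f ⊆ S := (mem_filter.1 (mem_coe.1 hf)).2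
      exact mem_coe.2 (mem_product.2 ⟨hfS (hp1 f), hfS (hp2 f)⟩)
    · by_contra hne
      exact hp f (hlin f g hne _ _ (hp1 f) (hfg ▸ hp1 g) (hp2 f) (hfg ▸ hp2 g))
  have hdeg : ∑ v, #(univ.filter fun g => v ∈ e g) = m * k := by
    simp only [card_filter]
    rw [sum_comm]
    simp only [sum_boole, filter_mem_eq_inter, univ_inter, Nat.cast_id, hcard, sum_const, card_univ,
      smul_eq_mul]
    rfl
  have hSm : (#S : ℝ) * (2 * k * √m) ≤ m * k := by
    calc (#S : ℝ) * (2 * k * √m) ≤ ∑ v ∈ S, (#(univ.filter fun g => v ∈ e g) : ℝ) := by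
          rw [← nsmul_eq_mul]
          exact card_nsmul_le_sum _ _ _ fun v hv => (not_le.1 (mem_filter.1 hv).2).le
      _ ≤ ∑ v, (#(univ.filter fun g => v ∈ e g) : ℝ) :=
          sum_le_sum_of_subset_of_nonneg (subset_univ S) fun _ _ _ => by positivity
      _ = m * k := by exact_mod_cast hdeg
  have hS2 : 2 * (#S : ℝ) ≤ √m := by
    rcases Nat.eq_zero_or_pos m with h0 | hpos
    · have hS0 : S = ∅ := filter_eq_empty_iff.2 fun v _ => by
        have : IsEmpty ι := Fintype.card_eq_zero_iff.1 h0
        simp [univ_eq_empty]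
        positivity
      simp [hS0]
    · have hk0 : (0 : ℝ) < k := by exact_mod_cast (by omega : 0 < k)
      have hs0 : 0 < √(m : ℝ) := Real.sqrt_pos.2 (by exact_mod_cast hpos)
      have hsq : √(m : ℝ) * √m = m := Real.mul_self_sqrt (by positivity)
      refine le_of_mul_le_mul_right ?_ (mul_pos hk0 hs0)
      nlinarith
  have hB4 : 4 * #B ≤ m := by
    have h1 : (4 * #B : ℝ) ≤ m := by
      have h2 : (#B : ℝ) ≤ #S * #S := by exact_mod_cast hBS
      have h3 := Real.mul_self_sqrt (Nat.cast_nonneg m : (0 : ℝ) ≤ m)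
      nlinarith [mul_self_le_mul_self (by positivity) hS2]
    exact_mod_cast h1
  have hcompl : B = univ.filter fun f => ¬ (e f ∩ univ.filter fun v =>
      (#(univ.filter fun g => v ∈ e g) : ℝ) ≤ 2 * k * √m).Nonempty := by
    ext f
    simp only [hB, hS, mem_filter, mem_univ, true_and, subset_iff, Finset.Nonempty, mem_inter,
      not_exists, not_and]
  have htot := card_filter_add_card_filter_not (s := (univ : Finset ι)) fun f =>
    (e f ∩ univ.filter fun v => (#(univ.filter fun g => v ∈ e g) : ℝ) ≤ 2 * k * √m).Nonempty
  rw [← hcompl, card_univ] at htot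
  omega

end Degree
/-! ### Cuts of large surplus -/

/-- The surplus bound for a finite linear hypergraph given by an indexed family of hyperedges. -/
theorem exists_coloring_surplus.{u, v} (k : ℕ) : ∃ C : ℝ, 0 < C ∧ ∀ r : ℕ, 2 ≤ r → r ≤ k →
    (4 ≤ k ∨ 3 ≤ r) → ∀ (V : Type u) (ι : Type v) [DecidableEq V] [Fintype V] [Fintype ι]
      (e : ι → Finset V), (∀ f, #(e f) = k) → Linear e → ∃ c : V → Fin r,
        C * (Fintype.card ι : ℝ) ^ (3 / 4 : ℝ) ≤ ∑ f, rainbow (e f) c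
          - Fintype.card ι * (Nat.stirlingSecond k r * r.factorial / (r : ℝ) ^ k) := by
  rcases Nat.lt_or_ge k 2 with hk | hk
  · exact ⟨1, one_pos, fun r h2 hrk => by omega⟩
  have hk1 : (1 : ℝ) ≤ k := by exact_mod_cast (by omega : 1 ≤ k)
  set a : ℝ := 1 / (k : ℝ) ^ k with ha
  have ha0 : 0 < a := by positivity
  have ha1 : a ≤ 1 := div_le_one_of_le₀ (one_le_pow₀ hk1) (by positivity)
  set p : ℝ := 2 ^ k with hp
  have hp1 : 1 ≤ p := one_le_pow₀ (by norm_num)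
  -- The coefficient `δ / m ^ (1 / 4)` of the test functions has to be small enough for the gain
  -- to exceed the loss, which is smaller by a factor of order `δ ^ 2`.
  set δ : ℝ := a / (32 * p ^ 2 * k ^ 4) with hδ
  have hδ0 : 0 < δ := by positivity
  have hδk : δ * (32 * p ^ 2 * k ^ 4) = a := by rw [hδ]; field_simp
  have hpk : 1 ≤ p ^ 2 * (k : ℝ) ^ 4 := one_le_mul_of_one_le_of_one_le (one_le_pow₀ hp1)
    (one_le_pow₀ hk1)
  have hδ1 : δ ≤ 1 := by nlinarith
  have hδδ : δ ^ 2 ≤ δ := by nlinarith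
  have hk24 : (k : ℝ) ^ 2 ≤ k ^ 4 := pow_le_pow_right₀ hk1 (by norm_num)
  have hδN : 2 * k ^ 2 * δ ^ 2 ≤ 1 / 2 := by
    have h1 : (k : ℝ) ^ 2 ≤ p ^ 2 * k ^ 4 :=
      hk24.trans (le_mul_of_one_le_left (by positivity) (one_le_pow₀ hp1))
    nlinarith [mul_le_mul_of_nonneg_left h1 hδ0.le, mul_le_mul_of_nonneg_left hδδ
      (by positivity : (0 : ℝ) ≤ k ^ 2)]
  refine ⟨δ * a / (8 * p), by positivity, fun r hr hrk hcond V ι _ _ _ e hcard hlin => ?_⟩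
  classical
  have : NeZero r := ⟨by omega⟩
  rcases Nat.eq_zero_or_pos (Fintype.card ι) with h0 | hpos
  · have : IsEmpty ι := Fintype.card_eq_zero_iff.1 h0
    exact ⟨fun _ => 0, by simp⟩
  obtain ⟨Y, hYL, hY⟩ := exists_subset_card_inter_eq_one e (fun f => (hcard f).le)
    (univ.filter fun v => (#(univ.filter fun g => v ∈ e g) : ℝ) ≤ 2 * k * √(Fintype.card ι))
  have hlow := card_le_two_mul_card_inter_nonempty hk hcard hlin
  set m := Fintype.card ι with hm
  set n₁ := #(univ.filter fun f => #(e f ∩ Y) = 1) with hn₁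
  have hmn : (m : ℝ) ≤ 2 * (p * n₁) := by
    rw [hp]
    exact_mod_cast hlow.trans (Nat.mul_le_mul_left 2 hY)
  have hm0 : (0 : ℝ) < m := by exact_mod_cast hpos
  set x : ℝ := (m : ℝ) ^ (1 / 4 : ℝ) with hx
  have hx0 : 0 < x := Real.rpow_pos_of_pos hm0 _
  have hx2 : √(m : ℝ) = x ^ 2 := by
    rw [hx, Real.sqrt_eq_rpow, ← Real.rpow_natCast, ← Real.rpow_mul hm0.le]; norm_num
  have hx3 : (m : ℝ) ^ (3 / 4 : ℝ) = x ^ 3 := by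
    rw [hx, ← Real.rpow_natCast, ← Real.rpow_mul hm0.le]; norm_num
  have hx4 : (m : ℝ) = x ^ 4 := by
    rw [hx, ← Real.rpow_natCast, ← Real.rpow_mul hm0.le]; norm_num
  have hd : ∀ v ∈ Y, (#(privateEdges e Y v) : ℝ) ≤ 2 * k * √m := fun v hv => by
    refine le_trans (Nat.cast_le.2 (card_le_card fun f hf => ?_)) (mem_filter.1 (hYL hv)).2
    exact mem_filter.2 ⟨mem_univ f, (mem_of_mem_privateEdges hf).1⟩
  obtain ⟨c, hc⟩ := exists_coloring_of_private hr hrk hcond hcard hlin (lam := δ / x)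
    (by positivity) (by positivity) (by
      have h1 : (δ / x) ^ 2 * x ^ 2 = δ ^ 2 := by rw [← mul_pow, div_mul_cancel₀ _ hx0.ne']
      rw [hx2]
      refine le_of_eq_of_le ?_ hδN
      linear_combination 2 * (k : ℝ) ^ 2 * h1) hd
  refine ⟨c, le_trans ?_ hc⟩
  have har : a ≤ 1 / (r : ℝ) ^ k := by
    rw [ha]
    gcongr
  have hn₁m : x ^ 4 / (2 * p) ≤ n₁ := by
    rw [div_le_iff₀ (by positivity), ← hx4]
    linarith
  have hgain : δ * a / (4 * p) * x ^ 3 ≤ n₁ * (δ / x / 2 * (1 / (r : ℝ) ^ k)) := by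
    calc δ * a / (4 * p) * x ^ 3 = x ^ 4 / (2 * p) * (δ / x / 2 * a) := by
          field_simp; ring
      _ ≤ _ := mul_le_mul hn₁m (mul_le_mul_of_nonneg_left har (by positivity)) (by positivity)
          (Nat.cast_nonneg _)
  have hloss : m * (p * (k * (2 * k * √m) * (k * (k * ((δ / x) ^ 3 * 2)))))
      ≤ δ * a / (8 * p) * x ^ 3 := by
    rw [hx2, hx4]
    calc x ^ 4 * (p * (k * (2 * k * x ^ 2) * (k * (k * ((δ / x) ^ 3 * 2)))))
        = δ * (4 * p * k ^ 4 * δ ^ 2) * x ^ 3 := by field_simp; ring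
      _ ≤ δ * (4 * p * k ^ 4 * δ) * x ^ 3 := by gcongr
      _ = δ * a / (8 * p) * x ^ 3 := by
          have h8 : a / (8 * p) = 4 * p * k ^ 4 * δ := by
            rw [div_eq_iff (by positivity)]
            linear_combination -hδk
          rw [mul_div_assoc, h8]
  rw [hx3]
  have hsplit : δ * a / (8 * p) * x ^ 3 = δ * a / (4 * p) * x ^ 3 - δ * a / (8 * p) * x ^ 3 := by
    field_simp; ring
  linarith

end RandomColoring

open RandomColoring in
/-- A colouring of the vertices lying in hyperedges, extended to all vertices, is a cut. -/
lemma Hypergraph.exists_cut_of_coloring {V : Type*} (H : Hypergraph V) {r k : ℕ} (hr : 0 < r)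
    [Fintype H.edgeSet] (e : H.edgeSet → Finset (⋃₀ H.edgeSet : Set V))
    (he : ∀ f v, v ∈ e f ↔ (v : V) ∈ (f : Set V)) (c : (⋃₀ H.edgeSet : Set V) → Fin r) :
    ∃ P : H.Cut r, P.surplus k = ∑ f, rainbow (e f) c
      - Fintype.card H.edgeSet * (Nat.stirlingSecond k r * r.factorial / (r : ℝ) ^ k) := by
  classical
  let g : V → Fin r := fun v => if h : v ∈ ⋃₀ H.edgeSet then c ⟨v, h⟩ else ⟨0, hr⟩
  refine ⟨⟨fun i => {v ∈ H.vertexSet | g v = i}, fun i j hij => ?_, ?_⟩, ?_⟩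
  · exact Set.disjoint_left.2 fun v hi hj => hij (hi.2.symm.trans hj.2)
  · ext v
    simp
  · have hmem : ∀ f : H.edgeSet, (∀ i, ((f : Set V) ∩ {v ∈ H.vertexSet | g v = i}).Nonempty)
        ↔ ∀ i, ∃ v ∈ e f, c v = i := by
      refine fun f => forall_congr' fun i => ?_
      constructor
      · rintro ⟨v, hvf, -, rfl⟩
        have hv : v ∈ ⋃₀ H.edgeSet := ⟨f, f.2, hvf⟩
        exact ⟨⟨v, hv⟩, (he f _).2 hvf, by simp only [g, dif_pos hv]⟩
      · rintro ⟨v, hv, rfl⟩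
        refine ⟨v, (he f v).1 hv, H.subset_vertexSet_of_mem_edgeSet' f.2 ((he f v).1 hv), ?_⟩
        simp only [g, dif_pos v.2]
    have hsize : ({f ∈ H.edgeSet | ∀ i, (f ∩ {v ∈ H.vertexSet | g v = i}).Nonempty}.ncard : ℝ)
        = ∑ f, rainbow (e f) c := by
      have h1 : {f ∈ H.edgeSet | ∀ i, (f ∩ {v ∈ H.vertexSet | g v = i}).Nonempty}
          = (fun f : H.edgeSet => (f : Set V)) ''
            (univ.filter fun f => ∀ i, ∃ v ∈ e f, c v = i : Finset H.edgeSet) := by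
        ext f
        simp only [Set.mem_ofPred_eq, Set.mem_image, coe_filter, mem_univ, true_and]
        constructor
        · exact fun hf => ⟨⟨f, hf.1⟩, (hmem ⟨f, hf.1⟩).1 hf.2, rfl⟩
        · rintro ⟨f, hf, rfl⟩
          exact ⟨f.2, (hmem f).2 hf⟩
      rw [h1, Set.ncard_image_of_injective _ Subtype.val_injective, Set.ncard_coe_finset,
        ← sum_boole]
      refine sum_congr rfl fun f _ => ?_
      unfold rainbow
      congr
    rw [Hypergraph.Cut.surplus, Hypergraph.Cut.size, hsize, ← Nat.card_coe_set_eq,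
      Nat.card_eq_fintype_card]
    ring

theorem mainTheorem2 (k : ℕ) :
    ∃ c : ℝ, 0 < c ∧
      ∀ r : ℕ, 2 ≤ r → r ≤ k → (4 ≤ k ∨ 3 ≤ r) →
        ∀ (V : Type*) (H : Hypergraph V) (m : ℕ),
          H.IsUniform k → H.IsLinear → H.edgeSet.encard = m →
            ∃ P : H.Cut r, c * (m : ℝ) ^ (3 / 4 : ℝ) ≤ P.surplus k := by
  classical
  obtain ⟨C, hC, hmain⟩ := RandomColoring.exists_coloring_surplus k
  refine ⟨C, hC, fun r hr hrk hcond V H m hunif hlin hm => ?_⟩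
  have hfin : H.edgeSet.Finite := Set.finite_of_encard_eq_coe hm
  have hefin : ∀ f ∈ H.edgeSet, f.Finite := fun f hf => Set.finite_of_encard_eq_coe (hunif f hf)
  have : Fintype H.edgeSet := hfin.fintype
  have : Fintype (⋃₀ H.edgeSet : Set V) := (hfin.sUnion hefin).fintype
  set e : H.edgeSet → Finset (⋃₀ H.edgeSet : Set V) := fun f => univ.filter fun v => (v : V) ∈ f.1
    with he
  have hmem : ∀ f v, v ∈ e f ↔ (v : V) ∈ (f : Set V) := fun f v => by simp [he]
  have hcard : ∀ f, #(e f) = k := fun f => by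
    have h1 : (f : Set V) = (fun v : (⋃₀ H.edgeSet : Set V) => (v : V)) '' (e f : Set _) := by
      ext v
      simp only [Set.mem_image, mem_coe, hmem]
      exact ⟨fun hv => ⟨⟨v, f, f.2, hv⟩, hv, rfl⟩, by rintro ⟨v, hv, rfl⟩; exact hv⟩
    have h2 := hunif f f.2
    rw [h1, Subtype.val_injective.encard_image, Set.encard_coe_eq_coe_finsetCard] at h2
    exact_mod_cast h2
  have hlin' : RandomColoring.Linear e := by
    intro f g hfg u v huf hug hvf hvg
    have h1 := hlin f f.2 g g.2 fun h => hfg (Subtype.ext h)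
    rw [Set.encard_le_one_iff] at h1
    exact Subtype.ext (h1 u v ⟨(hmem f u).1 huf, (hmem g u).1 hug⟩
      ⟨(hmem f v).1 hvf, (hmem g v).1 hvg⟩)
  obtain ⟨c, hc⟩ := hmain r hr hrk hcond _ _ e hcard hlin'
  obtain ⟨P, hP⟩ := H.exists_cut_of_coloring (k := k) (by omega) e hmem c
  refine ⟨P, ?_⟩
  have hmc : Fintype.card H.edgeSet = m := by
    rw [← Nat.card_eq_fintype_card, Nat.card_coe_set_eq, Set.ncard, hm, ENat.toNat_natCast]
  rw [hP, ← hmc]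
  exact hc
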